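/- \textbf{Setting.} Let $N\ge 0$, let $\xi_1,\dots,\xi_N,\eta,\zeta,\kappa,\tau\in\mathbb C$ with $\sinh\eta\ne0$, $\sinh\zeta\neq 0$, $\kappa\ne0$, and let $\alpha_-,\beta_-\in\mathbb C$ satisfy $\sinh\alpha_-\cosh\beta_-=\frac{\sinh\zeta}{2\kappa}$, $\cosh\alpha_-\sinh\beta_-=\frac{\cosh\zeta}{2\kappa}$. Let $\mathcal H=(\mathbb C^2)^{\otimes N}$, let $R(\lambda)$ be the six-vertex $R$-matrix, whose non-zero entries are $R_{11}=R_{44}=\sinh(\lambda+\eta)$, $R_{22}=R_{33}=\sinh\lambda$, $R_{23}=R_{32}=\sinh\eta$, and put $$K_-(\lambda)=\frac1{\sinh\zeta}\begin{pmatrix}\sinh(\lambda-\frac\eta2+\zeta)&\kappa e^{\tau}\sinh(2\lambda-\eta)\\ \kappa e^{-\tau}\sinh(2\lambda-\eta)&\sinh(\zeta-\lambda+\frac\eta2)\end{pmatrix},$$ $M(\lambda)=R_{0N}(\lambda-\xi_N-\frac\eta2)\cdots R_{01}(\lambda-\xi_1-\frac\eta2)$, $\hat M(\lambda)=(-1)^N\sigma^y_0M^{t_0}(-\lambda)\sigma_0^y$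 and $\mathcal U_-(\lambda)=M(\lambda)K_-(\lambda)\hat M(\lambda)$, all regarded as $2\times2$ matrices (in the auxiliary space $0$) of operators on $\mathcal H$. For gauge parameters $\alpha,\beta\in\mathbb C$ let $$\tilde G(\lambda|\beta)=\begin{pmatrix}e^{-[\lambda+(\alpha+\beta+1)\eta]}&e^{-[\lambda+(\alpha-\beta+1)\eta]}\\1&1\end{pmatrix}$$ (invertible iff $\sinh\beta\eta\neq0$) and define the gauged generators by $$\begin{pmatrix}\mathcal A_-(\lambda|\beta+2)&\mathcal B_-(\lambda|\beta)\\ \mathcal C_-(\lambda|\beta+2)&\mathcal D_-(\lambda|\beta)\end{pmatrix}=e^{-\lambda+\eta/2}\,\tilde G^{-1}(\lambda-\tfrac\eta2|\beta)\,\mathcal U_-(\lambda)\,\tilde G(\tfrac\eta2-\lambda|\beta).$$ Put $\langle\beta|=\bigotimes_{n=1}^N(-1,e^{-\alpha\eta+(N-n+\beta)\eta-\xi_n})$ and $|\beta\rangle=\bigotimes_{n=1}^N(e^{-\alpha\eta-(N-n+\beta)\eta-\xi_n},1)^t$. Write $\mathbf h=(h_1,\dots,h_N)\in\{0,1\}^N$,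 $a_{\mathbf h}(\lambda)=\prod_n\sinh(\lambda-\xi_n-(h_n-\frac12)\eta)$, and $\mathsf A_-(\lambda)=g_-(\lambda)a(\lambda)a(-\lambda-\eta)$ with $a(\lambda)=\prod_n\sinh(\lambda-\xi_n+\frac\eta2)$, $g_-(\lambda)=\frac{\sinh(\lambda+\alpha_--\eta/2)\cosh(\lambda+\beta_--\eta/2)}{\sinh\alpha_-\cosh\beta_-}$; let $q_n=\mathsf A_-(\xi_n+\frac\eta2)\mathsf A_-(\frac\eta2-\xi_n)$. For a normalization $c=(c_1,\dots,c_N)$ with all $c_n\in\mathbb C^*$ let, with the factors of the products in increasing order of $n$ from left to right, $$\langle\beta,\mathbf h|_c=\langle\beta|\prod_{n=1}^N\Big(\frac{\mathcal A_-(\frac\eta2-\xi_n|\beta+2)}{c_n}\Big)^{h_n},\qquad |\beta,\mathbf h\rangle_c=\prod_{n=1}^N\Big(\frac{\mathcal D_-(\xi_n+\frac\eta2|\beta)}{c_n}\Big)^{1-h_n}|-\beta+2\rangle ,$$ $$\langle\beta,\mathbf h|^{\mathcal C}_c=\langle-\beta+2|\prod_{n=1}^N\Big(\frac{\mathcal D_-(\frac\eta2-\xi_n|\beta-2)}{c_n}\Big)^{h_n},\qquad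 |\beta,\mathbf h\rangle^{\mathcal C}_c=\prod_{n=1}^N\Big(\frac{\mathcal A_-(\xi_n+\frac\eta2|\beta)}{c_n}\Big)^{1-h_n}|\beta\rangle .$$ (The choice $c_n=\mathsf A_-(\frac\eta2-\xi_n)$, when these numbers are non-zero, is the usual normalization of the first family.) \textbf{Theorem.} Assume that the inhomogeneities are generic in the sense that, modulo $i\pi$, $\xi_a\ne\xi_b+r\eta$ for all $a\ne b$ and $\xi_a\neq-\xi_b+r\eta$ for all $a,b$ (including $a=b$), $r\in\{-1,0,1\}$. Let $\alpha,\beta\in\mathbb C$, and let $c,c'$ be arbitrary normalizations. $\mathrm{I}_b$) Suppose $\sinh\beta\eta\ne0$, $\sinh(\beta-2)\eta\neq0$ and, for $\beta'=\beta-2j$ with $j=0,1,\dots,N-1$ and every integer $k$, $$(\alpha-\beta')\eta\ne(N-1)\eta-\tau-(-1)^k(\alpha_-+\beta_-)+i\pi k.\qquad(\mathrm{BL})$$ Then $\mathcal B_-(\lambda|\beta)$ is left pseudo-diagonalizable with simple pseudo-spectrum: the covectors $\langle\beta,\mathbf h|_c$ form a basis, $\langle\beta,\mathbf h|_c\,\mathcal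 B_-(\lambda|\beta)=\mathsf B_{\mathbf h}(\lambda|\beta)\,\langle\beta-2,\mathbf h|_{c'}$ for all $\lambda\in\mathbb C$, where $$\mathsf B_{\mathbf h}(\lambda|\beta)=(-1)^Ne^{(\beta+N)\eta}\prod_n\Big(\frac{c'_n}{c_n}\Big)^{h_n}a_{\mathbf h}(\lambda)a_{\mathbf h}(-\lambda)\frac{\sinh(2\lambda-\eta)\big(2\kappa\sinh[(N+\beta-\alpha-1)\eta-\tau]-e^{\zeta}\big)}{2\sinh\zeta\,\sinh\beta\eta},$$ and for $\mathbf h\ne\mathbf k$ the function $\mathsf B_{\mathbf h}(\cdot|\beta)$ is not a constant multiple (possibly zero) of $\mathsf B_{\mathbf k}(\cdot|\beta)$. These covectors carry an SOV representation: with $\mathbf h^{n,\pm}$ obtained from $\mathbf h$ by replacing $h_n$ by $h_n\pm1$, $$\langle\beta,\mathbf h|_c\mathcal A_-(-(\xi_n-\tfrac\eta2)|\beta+2)=c_n\langle\beta,\mathbf h^{n,+}|_c,\quad \langle\beta,\mathbf h|_c\mathcal A_-(\xi_n-\tfrac\eta2|\beta+2)=0\quad\text{if }h_n=0,$$ $$\langle\beta,\mathbf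 h|_c\mathcal A_-(\xi_n+\tfrac\eta2|\beta+2)=\frac{q_n}{c_n}\langle\beta,\mathbf h^{n,-}|_c,\quad \langle\beta,\mathbf h|_c\mathcal A_-(-(\xi_n+\tfrac\eta2)|\beta+2)=0\quad\text{if }h_n=1.$$ If (BL) holds for $\beta'=\beta-2N$ too, then the covectors $\langle\beta-2,\mathbf h|_{c'}$ also form a basis. $\mathrm{II}_b$) Suppose $\sinh\beta\eta\ne0$, $\sinh(\beta+2)\eta\neq0$ and, for $\beta'=\beta+2j$ with $0\le j\le N-1$ and every integer $k$, $$(\alpha-\beta')\eta\ne-(N+1)\eta-\tau-(-1)^k(\alpha_-+\beta_-)+i\pi k.\qquad(\mathrm{BR})$$ Then $\mathcal B_-(\lambda|\beta)$ is right pseudo-diagonalizable with simple pseudo-spectrum (in the same sense as in $\mathrm I_b$): the vectors $|\beta,\mathbf h\rangle_c$ form a basis and $\mathcal B_-(\lambda|\beta)|\beta,\mathbf h\rangle_c=\bar{\mathsf B}_{\mathbf h}(\lambda|\beta)\,|\beta+2,\mathbf h\rangle_{c'}$ with $$\bar{\mathsf B}_{\mathbf h}(\lambda|\beta)=(-1)^Ne^{(\beta-N)\eta}\prod_n\Big(\frac{c'_n}{c_n}\Big)^{1-h_n}a_{\mathbf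 h}(\lambda)a_{\mathbf h}(-\lambda)\frac{\sinh(2\lambda-\eta)\big(2\kappa\sinh[(\beta-1-N-\alpha)\eta-\tau]-e^{\zeta}\big)}{2\sinh\zeta\,\sinh\beta\eta}.$$ They carry an SOV representation: if $h_n=0$, $\mathcal D_-(\cdot|\beta)$ maps $|\beta,\mathbf h\rangle_c$ to $\frac{q_n}{c_n}|\beta,\mathbf h^{n,+}\rangle_c$ at the point $-(\xi_n-\frac\eta2)$ and to $0$ at $\xi_n-\frac\eta2$; if $h_n=1$, to $c_n|\beta,\mathbf h^{n,-}\rangle_c$ at $\xi_n+\frac\eta2$ and to $0$ at $-(\xi_n+\frac\eta2)$. If (BR) holds for $\beta'=\beta+2N$ too, the vectors $|\beta+2,\mathbf h\rangle_{c'}$ also form a basis. $\mathrm I_c$) Suppose $\sinh\beta\eta\neq0$, $\sinh(\beta-2)\eta\ne0$ and, for $\beta'=\beta+2j$ with $0\le j\le N-1$ and every integer $k$, $$(\alpha+\beta')\eta\ne(N+1)\eta-\tau-(-1)^k(\alpha_-+\beta_-)+i\pi k.\qquad(\mathrm{CL})$$ Then $\mathcal C_-(\lambda|\beta)$ is left pseudo-diagonalizable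 with simple pseudo-spectrum: the covectors $\langle\beta,\mathbf h|^{\mathcal C}_c$ form a basis and $\langle\beta,\mathbf h|^{\mathcal C}_c\,\mathcal C_-(\lambda|\beta)=\mathsf B_{\mathbf h}(\lambda|2-\beta)\langle\beta+2,\mathbf h|^{\mathcal C}_{c'}$; they carry an SOV representation, $\mathcal D_-(\cdot|\beta-2)$ acting on them by the same formulas as $\mathcal A_-(\cdot|\beta+2)$ on $\langle\beta,\mathbf h|_c$ in $\mathrm I_b$. If (CL) holds for $\beta'=\beta+2N$ too, the covectors $\langle\beta+2,\mathbf h|^{\mathcal C}_{c'}$ also form a basis. $\mathrm{II}_c$) Suppose $\sinh(\beta-2)\eta\ne0$, $\sinh(\beta-4)\eta\neq0$ and, for $\beta'=\beta-2j$ with $0\le j\le N-1$ and every integer $k$, $$(\alpha+\beta')\eta\ne-(N-1)\eta-\tau-(-1)^k(\alpha_-+\beta_-)+i\pi k.\qquad(\mathrm{CR})$$ Then $\mathcal C_-(\lambda|\beta)$ is right pseudo-diagonalizable with simple pseudo-spectrum: the vectors $|\beta,\mathbf h\rangle^{\mathcal C}_c$ form a basis and $\mathcal C_-(\lambda|\beta)|\beta,\mathbf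 h\rangle^{\mathcal C}_c=\bar{\mathsf B}_{\mathbf h}(\lambda|2-\beta)|\beta-2,\mathbf h\rangle^{\mathcal C}_{c'}$; they carry an SOV representation, $\mathcal A_-(\cdot|\beta)$ acting on them by the same formulas as $\mathcal D_-(\cdot|\beta)$ on $|\beta,\mathbf h\rangle_c$ in $\mathrm{II}_b$. If (CR) holds for $\beta'=\beta-2N$ too, the vectors $|\beta-2,\mathbf h\rangle^{\mathcal C}_{c'}$ also form a basis. -/

import Mathlib

namespace OpenXXZ

noncomputable section

/-- Labels in `{0,1}^N`: they label the spin basis of the quantum space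
(`0` is the first, `1` the second vector of the standard basis of `ℂ²`) and the pseudo-eigenstates. -/
abbrev Config (N : ℕ) : Type := Fin N → Fin 2

/-- The quantum space `(ℂ²)^{⊗ N}` (or its dual), written in the spin basis. -/
abbrev State (N : ℕ) : Type := Config N → ℂ

/-- Operators on the quantum space, as matrices in the spin basis.  They act on column vectors by
`Matrix.mulVec` and on row vectors (covectors) by `Matrix.vecMul`. -/
abbrev Op (N : ℕ) : Type := Matrix (Config N) (Config N) ℂ

/-- The parameters of the chain: inhomogeneities `ξ`, crossing parameter `η`, and the parameters
`ζ, κ, τ` of the boundary matrix `K₋`. -/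
structure Params (N : ℕ) where
  ξ : Fin N → ℂ
  η : ℂ
  ζ : ℂ
  κ : ℂ
  τ : ℂ

/-- The operator acting as `X` on the `n`-th tensor factor and as the identity on the others. -/
def siteOp {N : ℕ} (n : Fin N) (X : Matrix (Fin 2) (Fin 2) ℂ) : Op N :=
  Matrix.of fun s t => if ∀ m, m ≠ n → s m = t m then X (s n) (t n) else 0

/-- The six-vertex `R`-matrix on `ℂ² ⊗ ℂ²`, written as a `2 × 2` matrix over the first factor
whose entries are `2 × 2` matrices acting on the second factor. -/
def rMatrix (η u : ℂ) : Matrix (Fin 2) (Fin 2) (Matrix (Fin 2) (Fin 2) ℂ) :=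
  !![!![Complex.sinh (u + η), 0; 0, Complex.sinh u], !![0, 0; Complex.sinh η, 0];
     !![0, Complex.sinh η; 0, 0], !![Complex.sinh u, 0; 0, Complex.sinh (u + η)]]

/-- A scalar `2 × 2` matrix in the auxiliary space, acting trivially on the quantum space. -/
def auxLift (N : ℕ) (X : Matrix (Fin 2) (Fin 2) ℂ) : Matrix (Fin 2) (Fin 2) (Op N) :=
  X.map fun z => z • (1 : Op N)

def pauliY : Matrix (Fin 2) (Fin 2) ℂ := !![0, -Complex.I; Complex.I, 0]

namespace Params

variable {N : ℕ} (p : Params N)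

/-- The scalar boundary matrix `K₋(u)`. -/
def kMinus (u : ℂ) : Matrix (Fin 2) (Fin 2) ℂ :=
  (1 / Complex.sinh p.ζ) •
    !![Complex.sinh (u - p.η / 2 + p.ζ), p.κ * Complex.exp p.τ * Complex.sinh (2 * u - p.η);
       p.κ * Complex.exp (-p.τ) * Complex.sinh (2 * u - p.η), Complex.sinh (p.ζ - u + p.η / 2)]

/-- The bulk monodromy matrix `R_{0N}(u - ξ_N - η/2) ⋯ R_{01}(u - ξ_1 - η/2)`. -/
def bulkMonodromy (u : ℂ) : Matrix (Fin 2) (Fin 2) (Op N) :=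
  (List.ofFn fun n : Fin N =>
    (rMatrix p.η (u - p.ξ n - p.η / 2)).map (siteOp n)).reverse.prod

/-- `M̂(u) = (-1)^N σ^y M(-u)^{t₀} σ^y`, with the transposition in the auxiliary space only. -/
def bulkMonodromyHat (u : ℂ) : Matrix (Fin 2) (Fin 2) (Op N) :=
  ((-1 : ℂ) ^ N) •
    (auxLift N pauliY * (p.bulkMonodromy (-u)).transpose * auxLift N pauliY)

/-- The boundary monodromy matrix `𝒰₋(u) = M(u) K₋(u) M̂(u)`. -/
def boundaryMonodromy (u : ℂ) : Matrix (Fin 2) (Fin 2) (Op N) :=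
  p.bulkMonodromy u * auxLift N (p.kMinus u) * p.bulkMonodromyHat u

/-- The gauge matrix `G̃(u|β)`, with columns `X(u|β+1)` and `Y(u|β-1)`, where
`X(u|β) = (exp(-(u+(α+β)η)), 1)` and `Y(u|β) = (exp(-(u+(α-β)η)), 1)`.
It is invertible exactly when `sinh (β η) ≠ 0`. -/
def gauge (α β u : ℂ) : Matrix (Fin 2) (Fin 2) ℂ :=
  !![Complex.exp (-(u + (α + (β + 1)) * p.η)), Complex.exp (-(u + (α - (β - 1)) * p.η)); 1, 1]

/-- The gauge transformed boundary monodromy matrix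
`𝒰₋(u|β) = e^{-u+η/2} G̃(u-η/2|β)⁻¹ 𝒰₋(u) G̃(η/2-u|β)`. -/
def gaugedMonodromy (α β u : ℂ) : Matrix (Fin 2) (Fin 2) (Op N) :=
  Complex.exp (-u + p.η / 2) •
    (auxLift N (p.gauge α β (u - p.η / 2))⁻¹ * p.boundaryMonodromy u *
      auxLift N (p.gauge α β (p.η / 2 - u)))

/-- The gauged generator `𝒜₋(u|β)`: the upper left entry of `𝒰₋(u|β-2)`. -/
def opA (α β u : ℂ) : Op N := p.gaugedMonodromy α (β - 2) u 0 0

/-- The gauged generator `ℬ₋(u|β)`: the upper right entry of `𝒰₋(u|β)`. -/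
def opB (α β u : ℂ) : Op N := p.gaugedMonodromy α β u 0 1

/-- The gauged generator `𝒞₋(u|β)`: the lower left entry of `𝒰₋(u|β-2)`. -/
def opC (α β u : ℂ) : Op N := p.gaugedMonodromy α (β - 2) u 1 0

/-- The gauged generator `𝒟₋(u|β)`: the lower right entry of `𝒰₋(u|β)`. -/
def opD (α β u : ℂ) : Op N := p.gaugedMonodromy α β u 1 1

/-- The covector `⟨β| = ⊗ₙ (-1, exp(-αη + (N-n+β)η - ξₙ))`, `n = 1, …, N`. -/
def leftRef (α β : ℂ) : State N := fun s =>
  ∏ n : Fin N, (![-1, Complex.exp (-α * p.η + ((N : ℂ) - ((n : ℕ) + 1) + β) * p.η - p.ξ n)] :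
    Fin 2 → ℂ) (s n)

/-- The vector `|β⟩ = ⊗ₙ (exp(-αη - (N-n+β)η - ξₙ), 1)ᵗ`, `n = 1, …, N`. -/
def rightRef (α β : ℂ) : State N := fun s =>
  ∏ n : Fin N, (![Complex.exp (-α * p.η - ((N : ℂ) - ((n : ℕ) + 1) + β) * p.η - p.ξ n), 1] :
    Fin 2 → ℂ) (s n)

/-- `∏ₙ (T(η/2 - ξₙ) / cₙ)^{hₙ}`, the factors being ordered by increasing `n`. -/
def leftProduct (T : ℂ → Op N) (c : Fin N → ℂ) (h : Config N) : Op N :=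
  (List.ofFn fun n : Fin N => ((c n)⁻¹ • T (p.η / 2 - p.ξ n)) ^ (h n : ℕ)).prod

/-- `∏ₙ (T(ξₙ + η/2) / cₙ)^{1-hₙ}`, the factors being ordered by increasing `n`. -/
def rightProduct (T : ℂ → Op N) (c : Fin N → ℂ) (h : Config N) : Op N :=
  (List.ofFn fun n : Fin N => ((c n)⁻¹ • T (p.ξ n + p.η / 2)) ^ (1 - (h n : ℕ))).prod

/-- Left states for `ℬ₋`: `⟨β,h| = ⟨β| ∏ₙ (𝒜₋(η/2-ξₙ|β+2)/cₙ)^{hₙ}`. -/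
def leftStateB (α β : ℂ) (c : Fin N → ℂ) (h : Config N) : State N :=
  Matrix.vecMul (p.leftRef α β) (p.leftProduct (p.opA α (β + 2)) c h)

/-- Right states for `ℬ₋`: `|β,h⟩ = ∏ₙ (𝒟₋(ξₙ+η/2|β)/cₙ)^{1-hₙ} |-β+2⟩`. -/
def rightStateB (α β : ℂ) (c : Fin N → ℂ) (h : Config N) : State N :=
  Matrix.mulVec (p.rightProduct (p.opD α β) c h) (p.rightRef α (-β + 2))

/-- Left states for `𝒞₋`: `⟨-β+2| ∏ₙ (𝒟₋(η/2-ξₙ|β-2)/cₙ)^{hₙ}`. -/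
def leftStateC (α β : ℂ) (c : Fin N → ℂ) (h : Config N) : State N :=
  Matrix.vecMul (p.leftRef α (-β + 2)) (p.leftProduct (p.opD α (β - 2)) c h)

/-- Right states for `𝒞₋`: `∏ₙ (𝒜₋(ξₙ+η/2|β)/cₙ)^{1-hₙ} |β⟩`. -/
def rightStateC (α β : ℂ) (c : Fin N → ℂ) (h : Config N) : State N :=
  Matrix.mulVec (p.rightProduct (p.opA α β) c h) (p.rightRef α β)

/-- `a_h(u) = ∏ₙ sinh(u - ξₙ - (hₙ - 1/2) η)`. -/
def aH (h : Config N) (u : ℂ) : ℂ :=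
  ∏ n, Complex.sinh (u - p.ξ n - (((h n : ℕ) : ℂ) - 1 / 2) * p.η)

/-- The pseudo-eigenvalue of `ℬ₋(u|β)` on `⟨β,h|`, when the states at `β` are normalized by `c` and
those at `β-2` by `c'`. -/
def leftEig (α β : ℂ) (c c' : Fin N → ℂ) (h : Config N) (u : ℂ) : ℂ :=
  (-1) ^ N * Complex.exp ((β + N) * p.η) * (∏ n, (c' n / c n) ^ (h n : ℕ)) *
    p.aH h u * p.aH h (-u) *
    (Complex.sinh (2 * u - p.η) *
      (2 * p.κ * Complex.sinh ((N + β - α - 1) * p.η - p.τ) - Complex.exp p.ζ) /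
      (2 * Complex.sinh p.ζ * Complex.sinh (β * p.η)))

/-- The pseudo-eigenvalue of `ℬ₋(u|β)` on `|β,h⟩`, when the states at `β` are normalized by `c` and
those at `β+2` by `c'`. -/
def rightEig (α β : ℂ) (c c' : Fin N → ℂ) (h : Config N) (u : ℂ) : ℂ :=
  (-1) ^ N * Complex.exp ((β - N) * p.η) * (∏ n, (c' n / c n) ^ (1 - (h n : ℕ))) *
    p.aH h u * p.aH h (-u) *
    (Complex.sinh (2 * u - p.η) *
      (2 * p.κ * Complex.sinh ((β - (1 + N + α)) * p.η - p.τ) - Complex.exp p.ζ) /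
      (2 * Complex.sinh p.ζ * Complex.sinh (β * p.η)))

/-- `g₋(u)`, in terms of the boundary parameters `α₋, β₋`. -/
def gMinus (αm βm u : ℂ) : ℂ :=
  Complex.sinh (u + αm - p.η / 2) * Complex.cosh (u + βm - p.η / 2) /
    (Complex.sinh αm * Complex.cosh βm)

/-- `a(u) = ∏ₙ sinh(u - ξₙ + η/2)`. -/
def aBulk (u : ℂ) : ℂ := ∏ n, Complex.sinh (u - p.ξ n + p.η / 2)

/-- `A₋(u) = g₋(u) a(u) d(-u)`, where `d(u) = a(u - η)`. -/
def aMinus (αm βm u : ℂ) : ℂ := p.gMinus αm βm u * p.aBulk u * p.aBulk (-u - p.η)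

/-- `A₋(ξₙ + η/2) A₋(η/2 - ξₙ)`, the value of `det_q 𝒰₋(u) / sinh(2u - 2η)` at `u = ξₙ`. -/
def qDet (αm βm : ℂ) (n : Fin N) : ℂ :=
  p.aMinus αm βm (p.ξ n + p.η / 2) * p.aMinus αm βm (p.η / 2 - p.ξ n)

/-- Genericity of the inhomogeneities: all comparisons are modulo `iπ`, and besides the differences
the sums `ξ_a + ξ_b` (including `a = b`) are kept away from `-η, 0, η`. -/
def Generic : Prop :=
  ∀ a b : Fin N, ∀ r ∈ ({-1, 0, 1} : Set ℤ), ∀ m : ℤ,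
    (a ≠ b → p.ξ a ≠ p.ξ b + r * p.η + m * (Real.pi * Complex.I)) ∧
    p.ξ a ≠ -p.ξ b + r * p.η + m * (Real.pi * Complex.I)

/-- `α₋, β₋` are boundary parameters for `ζ, κ`:
`sinh α₋ cosh β₋ = sinh ζ / (2κ)` and `cosh α₋ sinh β₋ = cosh ζ / (2κ)`. -/
def IsBoundaryParam (αm βm : ℂ) : Prop :=
  Complex.sinh αm * Complex.cosh βm = Complex.sinh p.ζ / (2 * p.κ) ∧
  Complex.cosh αm * Complex.sinh βm = Complex.cosh p.ζ / (2 * p.κ)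

/-- Non-nilpotency, left action of `ℬ₋`:
`(α-β)η ≠ (N-1)η - τ - (-1)^k (α₋+β₋) + iπk` for all integers `k`. -/
def NonNilpBL (αm βm α β : ℂ) : Prop :=
  ∀ k : ℤ, (α - β) * p.η ≠
    (N - 1) * p.η - p.τ - (-1) ^ k * (αm + βm) + k * (Real.pi * Complex.I)

/-- Non-nilpotency, right action of `ℬ₋`:
`(α-β)η ≠ -(N+1)η - τ - (-1)^k (α₋+β₋) + iπk` for all integers `k`. -/
def NonNilpBR (αm βm α β : ℂ) : Prop :=
  ∀ k : ℤ, (α - β) * p.η ≠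
    -(N + 1) * p.η - p.τ - (-1) ^ k * (αm + βm) + k * (Real.pi * Complex.I)

/-- Non-nilpotency, left action of `𝒞₋`:
`(α+β)η ≠ (N+1)η - τ - (-1)^k (α₋+β₋) + iπk` for all integers `k`. -/
def NonNilpCL (αm βm α β : ℂ) : Prop :=
  ∀ k : ℤ, (α + β) * p.η ≠
    (N + 1) * p.η - p.τ - (-1) ^ k * (αm + βm) + k * (Real.pi * Complex.I)

/-- Non-nilpotency, right action of `𝒞₋`:
`(α+β)η ≠ -(N-1)η - τ - (-1)^k (α₋+β₋) + iπk` for all integers `k`. -/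
def NonNilpCR (αm βm α β : ℂ) : Prop :=
  ∀ k : ℤ, (α + β) * p.η ≠
    -(N - 1) * p.η - p.τ - (-1) ^ k * (αm + βm) + k * (Real.pi * Complex.I)

end Params

/-- The family `v`, indexed by `{0,1}^N`, is a basis of the quantum space. -/
def IsBasis {N : ℕ} (v : Config N → State N) : Prop :=
  LinearIndependent ℂ v ∧ Submodule.span ℂ (Set.range v) = ⊤

/-- Pseudo-diagonalizability with simple pseudo-spectrum, for a one-parameter family of operators
acting (from the left or from the right) by `act u`: the states `v h` at the gauge parameter `β` form
a basis and are mapped to multiples of the states `w h` at the shifted gauge parameter,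
`act u (v h) = ev h u • w h`, and the pseudo-eigenvalues `ev h`, as functions of `u`, are nonzero and
distinct, even up to a constant factor (they depend on the normalization of the states). -/
structure IsPseudoEigenbasis {N : ℕ} (act : ℂ → State N → State N)
    (v w : Config N → State N) (ev : Config N → ℂ → ℂ) : Prop where
  basis : IsBasis v
  pseudo : ∀ h u, act u (v h) = ev h u • w h
  simple : ∀ h k, h ≠ k → ∀ t : ℂ, ev h ≠ t • ev k

/-- In a separation of variables (SOV) representation the remaining generator, acting by `act u`, acts
on the states `v h` by shifts at the separate variables `±ζₙ`, `ζₙ = ξₙ + (hₙ - 1/2) η`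
(the zeros of the pseudo-eigenvalues): at `u = ζₙ` it lowers `hₙ` and at `u = -ζₙ` it raises `hₙ`,
a state with `hₙ ∉ {0,1}` being `0`. -/
def ActsByShifts {N : ℕ} (p : Params N) (act : ℂ → State N → State N)
    (v : Config N → State N) (lower raise : Fin N → ℂ) : Prop :=
  ∀ h n,
    (h n = 0 →
      act (p.ξ n - p.η / 2) (v h) = 0 ∧
      act (-(p.ξ n - p.η / 2)) (v h) = raise n • v (Function.update h n 1)) ∧
    (h n = 1 →
      act (p.ξ n + p.η / 2) (v h) = lower n • v (Function.update h n 0) ∧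
      act (-(p.ξ n + p.η / 2)) (v h) = 0)

/-- The action from the right on covectors (left states). -/
def leftAct {N : ℕ} (T : ℂ → Op N) : ℂ → State N → State N := fun u x => Matrix.vecMul x (T u)

/-- The action on vectors (right states). -/
def rightAct {N : ℕ} (T : ℂ → Op N) : ℂ → State N → State N := fun u x => Matrix.mulVec (T u) x

end

end OpenXXZ

/-! The proof is an induction on the number of sites. By crossing symmetry, adding a site turns the
boundary monodromy matrix `U` into `R(u-ξ-η/2) U(u) R(u+ξ-η/2)` (`Params.chain_succ`). This dressing
preserves the reflection equation (`Reflection.dress`) and the scalarity of `U(u) U(η-u)`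
(`dress_mul_dress`).

The first row of the inverse gauge matrix is proportional to `gaugeRow`, and the `R`-matrix
intertwines two gauge covectors while exchanging a shift of their gauge parameters. Label 0 at a new
site is a gauge covector with spectral parameter `ξ`. Label 1 is the gauge covector with `-ξ`, acted
on by `U(η/2-ξ)`, the site serving as auxiliary space. The reflection equation with second argument
`η/2-ξ` says that the dressed monodromy passes through this `U` with `ξ` replaced by `-ξ`
(`tens_siteState_vecMul_dress`), so both labels are handled at once. It follows that `ℬ₋` maps
`sovState` at `β` to a multiple of `sovState` at `β-2` (`Params.sovState_gaugedB`).

At `η/2-ξₙ` and `ξₙ+η/2` one of the two `R`-matrices of site `n` is a permutation, and it switches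
the label: `Params.gaugedRow_raise` creates the twist `U(η/2-ξₙ)`, `Params.gaugedRow_lower` cancels
it by unitarity. The two coefficients multiply to the quantum determinant `qₙ`. The covectors of the
theorem are therefore nonzero multiples of `sovState`.

For linear independence, contraction with a gauge vector kills the states with last label 0 and acts
as `ℬ₋` of the shorter chain on those with last label 1. Hence independence for `N+1` sites at `β`
follows from that for `N` sites at `β+1` and `β-1`, as long as the pseudo-eigenvalue is nonzero
(`Params.linearIndependent_sovState`). Because `sinh(α₋+β₋) = e^ζ/(2κ)`, condition (BL) is exactly
what keeps its boundary factor from vanishing.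

Right states reduce to left ones: the transpose, conjugated by `σᶻ` on all factors, is the monodromy
of a chain with `ξ → -ξ`, `τ → -τ+iπ` (`Params.mirror_chain`). The `𝒞₋` statements are the `ℬ₋`
statements at `2-β`, since `β → -β` swaps the columns of the gauge matrix. -/

namespace OpenXXZ

noncomputable section

open Matrix

set_option linter.unusedSectionVars false

/-! ### Operators with spectator factors and the Yang–Baxter equation -/

section Spectators

variable {ι : Type*} [Fintype ι] [DecidableEq ι]

/-- An operator on `ℂ² ⊗ V`, acting on the first and third factors of `ℂ² ⊗ ℂ² ⊗ V`. -/
def onFst (U : Matrix (Fin 2 × ι) (Fin 2 × ι) ℂ) :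
    Matrix (Fin 2 × Fin 2 × ι) (Fin 2 × Fin 2 × ι) ℂ :=
  Matrix.of fun p q => if p.2.1 = q.2.1 then U (p.1, p.2.2) (q.1, q.2.2) else 0

/-- An operator on `ℂ² ⊗ V`, acting on the second and third factors of `ℂ² ⊗ ℂ² ⊗ V`. -/
def onSnd (U : Matrix (Fin 2 × ι) (Fin 2 × ι) ℂ) :
    Matrix (Fin 2 × Fin 2 × ι) (Fin 2 × Fin 2 × ι) ℂ :=
  Matrix.of fun p q => if p.1 = q.1 then U p.2 q.2 else 0

/-- An operator on `ℂ² ⊗ ℂ² ⊗ V`, acting on `ℂ² ⊗ ℂ² ⊗ ℂ² ⊗ V` with the third factor as a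
spectator. -/
def skipThird (U : Matrix (Fin 2 × Fin 2 × ι) (Fin 2 × Fin 2 × ι) ℂ) :
    Matrix (Fin 2 × Fin 2 × Fin 2 × ι) (Fin 2 × Fin 2 × Fin 2 × ι) ℂ :=
  Matrix.of fun p q => if p.2.2.1 = q.2.2.1 then
    U (p.1, p.2.1, p.2.2.2) (q.1, q.2.1, q.2.2.2) else 0

/-- A scalar `8 × 8` matrix, acting on the first three factors of `ℂ² ⊗ ℂ² ⊗ ℂ² ⊗ V`. -/
def onThree (ι : Type*) [DecidableEq ι]
    (U : Matrix (Fin 2 × Fin 2 × Fin 2) (Fin 2 × Fin 2 × Fin 2) ℂ) :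
    Matrix (Fin 2 × Fin 2 × Fin 2 × ι) (Fin 2 × Fin 2 × Fin 2 × ι) ℂ :=
  Matrix.of fun p q => if p.2.2.2 = q.2.2.2 then
    U (p.1, p.2.1, p.2.2.1) (q.1, q.2.1, q.2.2.1) else 0

/-- The `R`-matrix, acting on the first two factors of `ℂ² ⊗ ℂ² ⊗ V`. -/
def rOp (ι : Type*) [DecidableEq ι] (η u : ℂ) :
    Matrix (Fin 2 × Fin 2 × ι) (Fin 2 × Fin 2 × ι) ℂ :=
  Matrix.of fun p q => if p.2.2 = q.2.2 then rMatrix η u p.1 q.1 p.2.1 q.2.1 else 0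

theorem onFst_mul (A B : Matrix (Fin 2 × ι) (Fin 2 × ι) ℂ) :
    onFst (A * B) = onFst A * onFst B := by
  ext ⟨i, a, x⟩ ⟨i', a', x'⟩
  fin_cases a <;> fin_cases a' <;> simp [onFst, mul_apply, Fintype.sum_prod_type]

theorem onSnd_mul (A B : Matrix (Fin 2 × ι) (Fin 2 × ι) ℂ) :
    onSnd (A * B) = onSnd A * onSnd B := by
  ext ⟨i, a, x⟩ ⟨i', a', x'⟩
  fin_cases i <;> fin_cases i' <;> simp [onSnd, mul_apply, Fintype.sum_prod_type]

theorem skipThird_mul (A B : Matrix (Fin 2 × Fin 2 × ι) (Fin 2 × Fin 2 × ι) ℂ) :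
    skipThird (A * B) = skipThird A * skipThird B := by
  ext ⟨i, j, a, x⟩ ⟨i', j', a', x'⟩
  fin_cases a <;> fin_cases a' <;> simp [skipThird, mul_apply, Fintype.sum_prod_type]

theorem onThree_mul (A B : Matrix (Fin 2 × Fin 2 × Fin 2) (Fin 2 × Fin 2 × Fin 2) ℂ) :
    onThree ι (A * B) = onThree ι A * onThree ι B := by
  ext ⟨i, j, a, x⟩ ⟨i', j', a', x'⟩
  by_cases h : x = x'
  · subst h
    simp [onThree, mul_apply, Fintype.sum_prod_type]
  · simp [onThree, mul_apply, Fintype.sum_prod_type, h]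

theorem skipThird_rOp (η u : ℂ) : skipThird (rOp ι η u) = rOp (Fin 2 × ι) η u := by
  ext ⟨i, j, a, x⟩ ⟨i', j', a', x'⟩
  simp only [skipThird, rOp, of_apply, Prod.mk.injEq]
  split_ifs <;> simp_all

theorem skipThird_onFst (U : Matrix (Fin 2 × ι) (Fin 2 × ι) ℂ) :
    skipThird (onFst U) = onFst (onFst U) := by
  ext ⟨i, j, a, x⟩ ⟨i', j', a', x'⟩
  simp only [skipThird, onFst, of_apply]
  split_ifs <;> simp_all

theorem skipThird_onSnd (U : Matrix (Fin 2 × ι) (Fin 2 × ι) ℂ) :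
    skipThird (onSnd U) = onSnd (onFst U) := by
  ext ⟨i, j, a, x⟩ ⟨i', j', a', x'⟩
  simp only [skipThird, onFst, onSnd, of_apply]
  split_ifs <;> simp_all

theorem onFst_onFst_comm_onSnd_rOp (U : Matrix (Fin 2 × ι) (Fin 2 × ι) ℂ) (η u : ℂ) :
    onFst (onFst U) * onSnd (rOp ι η u) = onSnd (rOp ι η u) * onFst (onFst U) := by
  ext ⟨i, j, a, x⟩ ⟨i', j', a', x'⟩
  simp [onFst, onSnd, rOp, mul_apply, Fintype.sum_prod_type, -Fin.sum_univ_two]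
  ring

theorem onSnd_onFst_comm_onFst_rOp (U : Matrix (Fin 2 × ι) (Fin 2 × ι) ℂ) (η u : ℂ) :
    onSnd (onFst U) * onFst (rOp ι η u) = onFst (rOp ι η u) * onSnd (onFst U) := by
  ext ⟨i, j, a, x⟩ ⟨i', j', a', x'⟩
  simp [onFst, onSnd, rOp, mul_apply, Fintype.sum_prod_type, -Fin.sum_univ_two]
  ring

/-- The scalar `R`-matrix on the first and second factors of `ℂ² ⊗ ℂ² ⊗ ℂ²`. -/
def r12 (η u : ℂ) : Matrix (Fin 2 × Fin 2 × Fin 2) (Fin 2 × Fin 2 × Fin 2) ℂ :=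
  Matrix.of fun p q => if p.2.2 = q.2.2 then rMatrix η u p.1 q.1 p.2.1 q.2.1 else 0

/-- The scalar `R`-matrix on the first and third factors. -/
def r13 (η u : ℂ) : Matrix (Fin 2 × Fin 2 × Fin 2) (Fin 2 × Fin 2 × Fin 2) ℂ :=
  Matrix.of fun p q => if p.2.1 = q.2.1 then rMatrix η u p.1 q.1 p.2.2 q.2.2 else 0

/-- The scalar `R`-matrix on the second and third factors. -/
def r23 (η u : ℂ) : Matrix (Fin 2 × Fin 2 × Fin 2) (Fin 2 × Fin 2 × Fin 2) ℂ :=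
  Matrix.of fun p q => if p.1 = q.1 then rMatrix η u p.2.1 q.2.1 p.2.2 q.2.2 else 0

theorem onThree_r12 (η u : ℂ) : onThree ι (r12 η u) = rOp (Fin 2 × ι) η u := by
  ext ⟨i, j, a, x⟩ ⟨i', j', a', x'⟩
  simp only [onThree, r12, rOp, of_apply, Prod.mk.injEq]
  split_ifs <;> simp_all

theorem onThree_r13 (η u : ℂ) : onThree ι (r13 η u) = onFst (rOp ι η u) := by
  ext ⟨i, j, a, x⟩ ⟨i', j', a', x'⟩
  simp only [onThree, r13, rOp, onFst, of_apply]
  split_ifs <;> simp_all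

theorem onThree_r23 (η u : ℂ) : onThree ι (r23 η u) = onSnd (rOp ι η u) := by
  ext ⟨i, j, a, x⟩ ⟨i', j', a', x'⟩
  simp only [onThree, r23, rOp, onSnd, of_apply]
  split_ifs <;> simp_all

set_option maxHeartbeats 4000000 in
theorem yangBaxter_scalar (η u v : ℂ) :
    r12 η u * r13 η (u + v) * r23 η v = r23 η v * r13 η (u + v) * r12 η u := by
  ext ⟨i, j, a⟩ ⟨i', j', a'⟩
  simp only [mul_apply, Fintype.sum_prod_type, Fin.sum_univ_two, r12, r13, r23, of_apply]
  fin_cases i <;> fin_cases j <;> fin_cases a <;> fin_cases i' <;> fin_cases j' <;>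
    fin_cases a' <;> simp [rMatrix] <;> first
    | ring1
    | (simp only [Complex.sinh, Complex.exp_add, Complex.exp_neg]; field_simp; ring1)

-- The Yang–Baxter equation with the second and third factors exchanged; it is an independent form
-- only in notation, since `R` is symmetric under exchange of its two factors. The reflection
-- equation needs both forms.
set_option maxHeartbeats 4000000 in
theorem yangBaxter_scalar' (η u v : ℂ) :
    r13 η u * r12 η (u + v) * r23 η v = r23 η v * r12 η (u + v) * r13 η u := by
  ext ⟨i, j, a⟩ ⟨i', j', a'⟩
  simp only [mul_apply, Fintype.sum_prod_type, Fin.sum_univ_two, r12, r13, r23, of_apply]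
  fin_cases i <;> fin_cases j <;> fin_cases a <;> fin_cases i' <;> fin_cases j' <;>
    fin_cases a' <;> simp [rMatrix] <;> first
    | ring1
    | (simp only [Complex.sinh, Complex.exp_add, Complex.exp_neg]; field_simp; ring1)

theorem yangBaxter (η u v : ℂ) :
    rOp (Fin 2 × ι) η u * onFst (rOp ι η (u + v)) * onSnd (rOp ι η v) =
      onSnd (rOp ι η v) * onFst (rOp ι η (u + v)) * rOp (Fin 2 × ι) η u := by
  simp only [← onThree_r12, ← onThree_r13, ← onThree_r23, ← onThree_mul, yangBaxter_scalar]

theorem yangBaxter' (η u v : ℂ) :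
    onFst (rOp ι η u) * rOp (Fin 2 × ι) η (u + v) * onSnd (rOp ι η v) =
      onSnd (rOp ι η v) * rOp (Fin 2 × ι) η (u + v) * onFst (rOp ι η u) := by
  simp only [← onThree_r12, ← onThree_r13, ← onThree_r23, ← onThree_mul, yangBaxter_scalar']

end Spectators

/-! ### The reflection equation and its stability under adding a site -/

section Dressing

variable {ι : Type*} [Fintype ι] [DecidableEq ι]

/-- The reflection equation. -/
def Reflection (η : ℂ) (U : ℂ → Matrix (Fin 2 × ι) (Fin 2 × ι) ℂ) : Prop :=
  ∀ u v, rOp ι η (u - v) * onFst (U u) * rOp ι η (u + v - η) * onSnd (U v) =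
    onSnd (U v) * rOp ι η (u + v - η) * onFst (U u) * rOp ι η (u - v)

/-- The boundary monodromy matrix obtained from `U` by adding a site, which becomes the first factor
of the new quantum space. -/
def dress (η ξ : ℂ) (U : ℂ → Matrix (Fin 2 × ι) (Fin 2 × ι) ℂ) (u : ℂ) :
    Matrix (Fin 2 × Fin 2 × ι) (Fin 2 × Fin 2 × ι) ℂ :=
  rOp ι η (u - ξ - η / 2) * onFst (U u) * rOp ι η (u + ξ - η / 2)

/-- Sklyanin's argument. Operators on disjoint factors commute, and the Yang–Baxter moves `y1`–`y4`
carry the `R`-matrices of the new site past one another until the four factors of the old reflection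
equation stand side by side. -/
theorem Reflection.dress {η : ℂ} {U : ℂ → Matrix (Fin 2 × ι) (Fin 2 × ι) ℂ}
    (hU : Reflection η U) (ξ : ℂ) : Reflection η (dress η ξ U) := by
  intro u v
  have hs := congrArg skipThird (hU u v)
  simp only [skipThird_mul, skipThird_rOp, skipThird_onFst, skipThird_onSnd] at hs
  simp only [OpenXXZ.dress, onFst_mul, onSnd_mul]
  have y1 := yangBaxter' (ι := ι) η (u + ξ - η / 2) (v - ξ - η / 2)
  have y2 := yangBaxter (ι := ι) η (u - v) (v - ξ - η / 2)
  have y3 := yangBaxter (ι := ι) η (u - v) (v + ξ - η / 2)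
  have y4 := yangBaxter' (ι := ι) η (u - ξ - η / 2) (v + ξ - η / 2)
  rw [show u + ξ - η / 2 + (v - ξ - η / 2) = u + v - η by ring] at y1
  rw [show u - v + (v - ξ - η / 2) = u - ξ - η / 2 by ring] at y2
  rw [show u - v + (v + ξ - η / 2) = u + ξ - η / 2 by ring] at y3
  rw [show u - ξ - η / 2 + (v + ξ - η / 2) = u + v - η by ring] at y4
  have c1 := onFst_onFst_comm_onSnd_rOp (U u) η (v - ξ - η / 2)
  have c1' := onFst_onFst_comm_onSnd_rOp (U u) η (v + ξ - η / 2)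
  have c2 := onSnd_onFst_comm_onFst_rOp (U v) η (u - ξ - η / 2)
  have c2' := onSnd_onFst_comm_onFst_rOp (U v) η (u + ξ - η / 2)
  set a := rOp (Fin 2 × ι) η (u - v)
  set b := rOp (Fin 2 × ι) η (u + v - η)
  set U1 := onFst (onFst (U u))
  set U2 := onSnd (onFst (U v))
  set p := onFst (rOp ι η (u - ξ - η / 2))
  set p' := onFst (rOp ι η (u + ξ - η / 2))
  set q := onSnd (rOp ι η (v - ξ - η / 2))
  set q' := onSnd (rOp ι η (v + ξ - η / 2))
  calc a * (p * U1 * p') * b * (q * U2 * q')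
      = a * p * U1 * (p' * b * q) * U2 * q' := by simp only [mul_assoc]
    _ = a * p * (U1 * q) * b * (p' * U2) * q' := by rw [y1]; simp only [mul_assoc]
    _ = (a * p * q) * U1 * b * U2 * p' * q' := by rw [c1, ← c2']; simp only [mul_assoc]
    _ = q * p * (a * U1 * b * U2) * p' * q' := by rw [y2]; simp only [mul_assoc]
    _ = q * (p * U2) * b * U1 * (a * p' * q') := by rw [hs]; simp only [mul_assoc]
    _ = q * U2 * p * b * (U1 * q') * p' * a := by rw [y3, ← c2]; simp only [mul_assoc]
    _ = q * U2 * (p * b * q') * U1 * p' * a := by rw [c1']; simp only [mul_assoc]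
    _ = q * U2 * q' * b * (p * U1 * p') * a := by rw [y4]; simp only [mul_assoc]

theorem rOp_mul_rOp_neg (η u : ℂ) : rOp ι η u * rOp ι η (-u) =
    (Complex.sinh (η + u) * Complex.sinh (η - u)) • (1 : Matrix (Fin 2 × Fin 2 × ι) _ ℂ) := by
  ext ⟨i, a, x⟩ ⟨i', a', x'⟩
  by_cases h : x = x'
  · subst h
    simp only [mul_apply, Fintype.sum_prod_type, Fin.sum_univ_two, rOp, of_apply, Finset.sum_ite_eq,
      Finset.mem_univ, if_true, ite_mul, zero_mul, Matrix.smul_apply, one_apply, Prod.mk.injEq, and_true]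
    fin_cases i <;> fin_cases a <;> fin_cases i' <;> fin_cases a' <;> simp [rMatrix] <;>
      simp only [Complex.sinh, Complex.exp_add, Complex.exp_neg, sub_eq_add_neg] <;>
      field_simp <;> ring
  · simp [mul_apply, Fintype.sum_prod_type, rOp, one_apply, h]

theorem onFst_smul_one (c : ℂ) :
    onFst (c • (1 : Matrix (Fin 2 × ι) (Fin 2 × ι) ℂ)) = c • 1 := by
  ext ⟨i, a, x⟩ ⟨i', a', x'⟩
  simp only [onFst, of_apply, Matrix.smul_apply, one_apply, Prod.mk.injEq]
  split_ifs <;> simp_all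

/-- The two inner `R`-matrices have opposite arguments and cancel to a scalar; then `U(u) U(η-u)`
does, and finally the two outer `R`-matrices. -/
theorem dress_mul_dress {η ξ φ : ℂ} {U : ℂ → Matrix (Fin 2 × ι) (Fin 2 × ι) ℂ} {u : ℂ}
    (hU : U u * U (η - u) = φ • 1) :
    dress η ξ U u * dress η ξ U (η - u) =
      (Complex.sinh (η / 2 + u + ξ) * Complex.sinh (3 * η / 2 - u - ξ) *
        (Complex.sinh (η / 2 + u - ξ) * Complex.sinh (3 * η / 2 - u + ξ)) * φ) • 1 := by
  have h1 := rOp_mul_rOp_neg (ι := ι) η (u + ξ - η / 2)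
  have h2 := rOp_mul_rOp_neg (ι := ι) η (u - ξ - η / 2)
  have h3 := congrArg onFst hU
  rw [onFst_mul, onFst_smul_one] at h3
  calc dress η ξ U u * dress η ξ U (η - u)
      = rOp ι η (u - ξ - η / 2) * onFst (U u) *
          (rOp ι η (u + ξ - η / 2) * rOp ι η (-(u + ξ - η / 2))) * onFst (U (η - u)) *
          rOp ι η (-(u - ξ - η / 2)) := by
        rw [show -(u + ξ - η / 2) = η - u - ξ - η / 2 by ring,
          show -(u - ξ - η / 2) = η - u + ξ - η / 2 by ring]
        simp only [dress, mul_assoc]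
    _ = (Complex.sinh (η + (u + ξ - η / 2)) * Complex.sinh (η - (u + ξ - η / 2))) •
          (rOp ι η (u - ξ - η / 2) * (onFst (U u) * onFst (U (η - u))) *
          rOp ι η (-(u - ξ - η / 2))) := by
        rw [h1]
        simp only [mul_assoc, Matrix.smul_mul, Matrix.mul_smul, one_mul]
    _ = _ := by
        rw [h3]
        simp only [Matrix.smul_mul, Matrix.mul_smul, mul_one]
        rw [h2, smul_smul, smul_smul]
        congr 1
        rw [show η + (u + ξ - η / 2) = η / 2 + u + ξ by ring,
          show η - (u + ξ - η / 2) = 3 * η / 2 - u - ξ by ring,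
          show η + (u - ξ - η / 2) = η / 2 + u - ξ by ring,
          show η - (u - ξ - η / 2) = 3 * η / 2 - u + ξ by ring]
        ring

end Dressing

/-! ### Gauge covectors and their intertwining by the `R`-matrix -/

section Covectors

variable {ι : Type*} [Fintype ι] [DecidableEq ι]

/-- The tensor product of a covector of `ℂ²` with a covector of `V`. -/
def tens (y : Fin 2 → ℂ) (ψ : ι → ℂ) : Fin 2 × ι → ℂ := fun p => y p.1 * ψ p.2

/-- Insertion of a covector of `ℂ²` between the two factors of a covector of `ℂ² ⊗ V`. -/
def insertSnd (y : Fin 2 → ℂ) (w : Fin 2 × ι → ℂ) : Fin 2 × Fin 2 × ι → ℂ :=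
  fun p => w (p.1, p.2.2) * y p.2.1

/-- Contraction of a covector of `ℂ² ⊗ V` with a vector of `ℂ²`. -/
def contr (x : Fin 2 → ℂ) (w : Fin 2 × ι → ℂ) : ι → ℂ := fun s => ∑ i, w (i, s) * x i

theorem insertSnd_tens (y z : Fin 2 → ℂ) (ψ : ι → ℂ) :
    insertSnd z (tens y ψ) = tens y (tens z ψ) := by
  ext ⟨i, a, x⟩
  simp only [insertSnd, tens]
  ring

theorem tens_smul (y : Fin 2 → ℂ) (c : ℂ) (ψ : ι → ℂ) : tens y (c • ψ) = c • tens y ψ := by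
  ext ⟨i, x⟩
  simp only [tens, Pi.smul_apply, smul_eq_mul]
  ring

theorem insertSnd_smul (y : Fin 2 → ℂ) (c : ℂ) (w : Fin 2 × ι → ℂ) :
    insertSnd y (c • w) = c • insertSnd y w := by
  ext ⟨i, x⟩
  simp only [insertSnd, Pi.smul_apply, smul_eq_mul]
  ring

theorem contr_smul (y : Fin 2 → ℂ) (c : ℂ) (w : Fin 2 × ι → ℂ) :
    contr y (c • w) = c • contr y w := by
  ext x
  simp only [contr, Pi.smul_apply, smul_eq_mul, Finset.mul_sum, mul_assoc]

theorem contr_tens (x y : Fin 2 → ℂ) (ψ : ι → ℂ) :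
    contr x (tens y ψ) = (∑ i, y i * x i) • ψ := by
  ext s
  simp only [contr, tens, Pi.smul_apply, smul_eq_mul, Finset.sum_mul]
  exact Finset.sum_congr rfl fun i _ => by ring

theorem insertSnd_vecMul_onFst (y : Fin 2 → ℂ) (w : Fin 2 × ι → ℂ)
    (U : Matrix (Fin 2 × ι) (Fin 2 × ι) ℂ) :
    insertSnd y w ᵥ* onFst U = insertSnd y (w ᵥ* U) := by
  ext ⟨i, a, x⟩
  simp only [insertSnd, onFst, vecMul, dotProduct, Fintype.sum_prod_type, of_apply, mul_ite,
    mul_zero, Finset.sum_mul]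
  refine Finset.sum_congr rfl fun j _ => ?_
  rw [Finset.sum_comm]
  refine Finset.sum_congr rfl fun x' _ => ?_
  rw [Finset.sum_ite_eq' Finset.univ a]
  simp
  ring

theorem tens_vecMul_onSnd (y : Fin 2 → ℂ) (w : Fin 2 × ι → ℂ)
    (U : Matrix (Fin 2 × ι) (Fin 2 × ι) ℂ) :
    tens y w ᵥ* onSnd U = tens y (w ᵥ* U) := by
  ext ⟨i, a, x⟩
  fin_cases i <;> simp [tens, onSnd, vecMul, dotProduct, Fintype.sum_prod_type] <;>
    simp only [mul_add, Finset.mul_sum, mul_assoc]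

theorem contr_vecMul_onSnd (y : Fin 2 → ℂ) (w : Fin 2 × Fin 2 × ι → ℂ)
    (U : Matrix (Fin 2 × ι) (Fin 2 × ι) ℂ) :
    contr y (w ᵥ* onSnd U) = contr y w ᵥ* U := by
  ext ⟨a, x⟩
  simp [contr, onSnd, vecMul, dotProduct, Fintype.sum_prod_type]
  simp only [add_mul, Finset.sum_mul, Finset.sum_add_distrib]
  simp only [mul_right_comm _ _ (y _)]
  ring

theorem vecMul_rOp_apply (w : Fin 2 × Fin 2 × ι → ℂ) (η u : ℂ) (j b : Fin 2) (x : ι) :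
    (w ᵥ* rOp ι η u) (j, b, x) = ∑ i, ∑ a, w (i, a, x) * rMatrix η u i j a b := by
  simp [rOp, vecMul, dotProduct, Fintype.sum_prod_type]

/-- `R(0)` is `sinh η` times the permutation of the two factors. -/
theorem insertSnd_vecMul_rOp_zero (y : Fin 2 → ℂ) (w : Fin 2 × ι → ℂ) (η : ℂ) :
    insertSnd y w ᵥ* rOp ι η 0 = Complex.sinh η • tens y w := by
  ext ⟨j, b, x⟩
  rw [vecMul_rOp_apply]
  fin_cases j <;> fin_cases b <;> simp [insertSnd, tens, rMatrix] <;> ring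

theorem tens_vecMul_rOp_zero (y : Fin 2 → ℂ) (w : Fin 2 × ι → ℂ) (η : ℂ) :
    tens y w ᵥ* rOp ι η 0 = Complex.sinh η • insertSnd y w := by
  ext ⟨j, b, x⟩
  rw [vecMul_rOp_apply]
  fin_cases j <;> fin_cases b <;> simp [insertSnd, tens, rMatrix] <;> ring

/-- The gauge covector `(-1, exp(-(u + (α - b) η)))`. -/
def gaugeRow (α η u b : ℂ) : Fin 2 → ℂ := ![-1, Complex.exp (-(u + (α - b) * η))]

/-- The gauge vector `(exp(-(u + (α - b) η)), 1)`, which is annihilated by `gaugeRow`. -/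
def gaugeCol (α η u b : ℂ) : Fin 2 → ℂ := ![Complex.exp (-(u + (α - b) * η)), 1]

variable (α η u v b : ℂ)

/-- The vertex-face relation: a product of gauge covectors whose parameters differ by one stays a
product, and the shift moves from one covector to the other. -/
theorem gaugeRow_gaugeRow_rOp (ψ : ι → ℂ) :
    tens (gaugeRow α η u (b - 1)) (tens (gaugeRow α η v b) ψ) ᵥ* rOp ι η (u - v) =
      Complex.sinh (u - v + η) • tens (gaugeRow α η u b) (tens (gaugeRow α η v (b - 1)) ψ) := by
  ext ⟨j, b, x⟩
  rw [vecMul_rOp_apply]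
  fin_cases j <;> fin_cases b <;> simp [gaugeRow, tens, rMatrix] <;>
    simp only [Complex.sinh, Complex.exp_add, Complex.exp_neg, sub_eq_add_neg, add_mul, neg_mul,
      one_mul, neg_add, neg_neg] <;>
    field_simp <;> ring

/-- The reverse move. Where the hyperbolic sines do not vanish it follows from `R(w) R(-w)` being
scalar; the direct check covers the remaining points as well. -/
theorem gaugeRow_gaugeRow_rOp' (ψ : ι → ℂ) :
    tens (gaugeRow α η u b) (tens (gaugeRow α η v (b - 1)) ψ) ᵥ* rOp ι η (v - u) =
      Complex.sinh (v - u + η) • tens (gaugeRow α η u (b - 1)) (tens (gaugeRow α η v b) ψ) := by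
  ext ⟨j, b, x⟩
  rw [vecMul_rOp_apply]
  fin_cases j <;> fin_cases b <;> simp [gaugeRow, tens, rMatrix] <;>
    simp only [Complex.sinh, Complex.exp_add, Complex.exp_neg, sub_eq_add_neg, add_mul, neg_mul,
      one_mul, neg_add, neg_neg] <;>
    field_simp <;> ring

/-- With a gauge vector at the output of the auxiliary space, the covector of the site and this
vector pass each other with opposite shifts of their gauge parameters. Since `w` is arbitrary, this
applies after the inner monodromy has acted. -/
theorem contr_gaugeCol_gaugeRow_rOp (w : Fin 2 × ι → ℂ) :
    contr (gaugeCol α η u b) (insertSnd (gaugeRow α η v b) w ᵥ* rOp ι η (v - u)) =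
      Complex.sinh (v - u) •
        tens (gaugeRow α η v (b - 1)) (contr (gaugeCol α η u (b + 1)) w) := by
  ext ⟨a, x⟩
  simp only [contr, vecMul_rOp_apply, Fin.sum_univ_two]
  fin_cases a <;> simp [gaugeRow, gaugeCol, insertSnd, contr, tens, rMatrix] <;>
    simp only [Complex.sinh, Complex.exp_add, Complex.exp_neg, sub_eq_add_neg, add_mul, neg_mul,
      one_mul, neg_add, neg_neg] <;>
    field_simp <;> ring

end Covectors

/-! ### Action of the dressed monodromy on the two states of a new site -/

section SiteStates

variable {ι : Type*} [Fintype ι] [DecidableEq ι]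

/-- `ξ` or `-ξ`, depending on the label of the site. -/
def flipSign (a : Fin 2) (ξ : ℂ) : ℂ := if a = 0 then ξ else -ξ

/-- The operator relating the states of a site with label `a` to product states. -/
def siteTwist (η ξ : ℂ) (U : ℂ → Matrix (Fin 2 × ι) (Fin 2 × ι) ℂ) (a : Fin 2) :
    Matrix (Fin 2 × ι) (Fin 2 × ι) ℂ := if a = 0 then 1 else U (η / 2 - ξ)

/-- The state with label `a` at the last site and given by `ψ` on the other sites. -/
def siteState (α η ξ : ℂ) (U : ℂ → Matrix (Fin 2 × ι) (Fin 2 × ι) ℂ) (β : ℂ) (a : Fin 2)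
    (ψ : ι → ℂ) : Fin 2 × ι → ℂ :=
  tens (gaugeRow α η (flipSign a ξ) β) ψ ᵥ* siteTwist η ξ U a

variable {α η ξ β : ℂ} {U : ℂ → Matrix (Fin 2 × ι) (Fin 2 × ι) ℂ}

theorem siteState_zero (ψ : ι → ℂ) :
    siteState α η ξ U β 0 ψ = tens (gaugeRow α η ξ β) ψ := by
  simp [siteState, siteTwist, flipSign]

theorem siteState_one (ψ : ι → ℂ) :
    siteState α η ξ U β 1 ψ = tens (gaugeRow α η (-ξ) β) ψ ᵥ* U (η / 2 - ξ) := by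
  simp [siteState, siteTwist, flipSign]

/-- For label 1, the reflection equation at `v = η/2 - ξ` has `u - v = u+ξ-η/2` and `u + v - η =
u-ξ-η/2`: these are the two `R`-arguments of the dressing, in exchanged order. The dressing thus
moves through the twist `U(η/2-ξ)` with `ξ` turned into `-ξ`. -/
theorem tens_siteState_vecMul_dress (hU : Reflection η U) (a : Fin 2) (y : Fin 2 → ℂ) (ψ : ι → ℂ)
    (u : ℂ) :
    tens y (siteState α η ξ U β a ψ) ᵥ* dress η ξ U u =
      tens y (tens (gaugeRow α η (flipSign a ξ) β) ψ) ᵥ* rOp ι η (u - η / 2 - flipSign a ξ) ᵥ*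
        onFst (U u) ᵥ* rOp ι η (flipSign a ξ - (η / 2 - u)) ᵥ* onSnd (siteTwist η ξ U a) := by
  fin_cases a
  · have h1 : onSnd (siteTwist η ξ U 0) = 1 := by
      ext ⟨i, a, x⟩ ⟨j, b, z⟩
      simp only [onSnd, siteTwist, of_apply, if_true, one_apply, Prod.mk.injEq]
      split_ifs <;> simp_all
    simp only [Fin.zero_eta, h1, vecMul_one, siteState_zero, flipSign, if_true, dress, vecMul_vecMul]
    rw [show u - η / 2 - ξ = u - ξ - η / 2 by ring, show ξ - (η / 2 - u) = u + ξ - η / 2 by ring]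
  · have h := hU u (η / 2 - ξ)
    rw [show u - (η / 2 - ξ) = u + ξ - η / 2 by ring,
      show u + (η / 2 - ξ) - η = u - ξ - η / 2 by ring] at h
    simp only [Fin.mk_one, siteState_one, ← tens_vecMul_onSnd, vecMul_vecMul]
    simp only [flipSign, siteTwist, one_ne_zero, if_false]
    rw [show u - η / 2 - -ξ = u + ξ - η / 2 by ring, show -ξ - (η / 2 - u) = u - ξ - η / 2 by ring]
    rw [h]
    simp only [dress, mul_assoc]

/-- Each of the two `R`-matrices lowers the gauge parameter of the site covector by one, hence the
total shift from `β` to `β-2`. In between, the inner chain sees the auxiliary gauge parameter `β`,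
which is the one belonging to its own states at `β+1`. -/
theorem siteState_gaugedB (hU : Reflection η U) (a : Fin 2) {ψ ψ' : ι → ℂ} {u E : ℂ}
    (hψ : contr (gaugeCol α η (η / 2 - u) β)
      (tens (gaugeRow α η (u - η / 2) β) ψ ᵥ* U u) = E • ψ') :
    contr (gaugeCol α η (η / 2 - u) (β - 1))
      (tens (gaugeRow α η (u - η / 2) (β - 1)) (siteState α η ξ U β a ψ) ᵥ* dress η ξ U u) =
      (Complex.sinh (u - flipSign a ξ + η / 2) * Complex.sinh (u + flipSign a ξ - η / 2) * E) •
        siteState α η ξ U (β - 2) a ψ' := by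
  rw [tens_siteState_vecMul_dress hU, gaugeRow_gaugeRow_rOp, contr_vecMul_onSnd]
  simp only [smul_vecMul, ← insertSnd_tens]
  rw [insertSnd_vecMul_onFst, contr_smul, contr_gaugeCol_gaugeRow_rOp, sub_add_cancel, hψ, tens_smul]
  simp only [smul_smul, smul_vecMul, siteState]
  rw [show β - 1 - 1 = β - 2 by ring, show u - η / 2 - flipSign a ξ + η = u - flipSign a ξ + η / 2 by ring,
    show flipSign a ξ - (η / 2 - u) = u + flipSign a ξ - η / 2 by ring, ← mul_assoc]

/-- If the inner row has rank one, the second `R`-matrix undoes the shift made by the first. The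
coefficient is even in `flipSign a ξ`, so it does not depend on the label. -/
theorem siteState_gaugedRow (hU : Reflection η U) (a : Fin 2) {ψ ψ' : ι → ℂ} {u k : ℂ}
    (hψ : tens (gaugeRow α η (u - η / 2) β) ψ ᵥ* U u =
      k • tens (gaugeRow α η (η / 2 - u) β) ψ') :
    tens (gaugeRow α η (u - η / 2) (β - 1)) (siteState α η ξ U β a ψ) ᵥ* dress η ξ U u =
      (Complex.sinh (u - ξ + η / 2) * Complex.sinh (u + ξ + η / 2) * k) •
        tens (gaugeRow α η (η / 2 - u) (β - 1)) (siteState α η ξ U β a ψ') := by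
  rw [tens_siteState_vecMul_dress hU, gaugeRow_gaugeRow_rOp]
  simp only [smul_vecMul, ← insertSnd_tens]
  rw [insertSnd_vecMul_onFst, hψ, insertSnd_smul, insertSnd_tens]
  simp only [smul_vecMul]
  rw [gaugeRow_gaugeRow_rOp']
  simp only [smul_smul, smul_vecMul, tens_vecMul_onSnd]
  congr 1
  rw [show u - η / 2 - flipSign a ξ + η = u - flipSign a ξ + η / 2 by ring,
    show flipSign a ξ - (η / 2 - u) + η = u + flipSign a ξ + η / 2 by ring]
  fin_cases a
  · simp [flipSign]; ring
  · simp only [flipSign, Fin.mk_one, one_ne_zero, if_false, sub_neg_eq_add, ← sub_eq_add_neg]; ring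

/-- At this point the coefficient of the first intertwining is `sinh 0`. -/
theorem siteState_gaugedRow_eq_zero (hU : Reflection η U) (a : Fin 2) (ψ : ι → ℂ) :
    tens (gaugeRow α η (flipSign a ξ - η / 2 - η / 2) (β - 1)) (siteState α η ξ U β a ψ) ᵥ*
      dress η ξ U (flipSign a ξ - η / 2) = 0 := by
  rw [tens_siteState_vecMul_dress hU, gaugeRow_gaugeRow_rOp,
    show flipSign a ξ - η / 2 - η / 2 - flipSign a ξ + η = 0 by ring]
  simp

/-- The right `R`-matrix is a permutation here. It exchanges site and auxiliary space after
`U(η/2-ξ)` has acted, which is precisely how the label 1 state is built. -/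
theorem siteState_gaugedRow_raise (ψ : ι → ℂ) :
    tens (gaugeRow α η (-ξ) (β - 1)) (siteState α η ξ U β 0 ψ) ᵥ* dress η ξ U (η / 2 - ξ) =
      (Complex.sinh (η - 2 * ξ) * Complex.sinh η) •
        tens (gaugeRow α η ξ (β - 1)) (siteState α η ξ U β 1 ψ) := by
  rw [siteState_zero, siteState_one, dress, show η / 2 - ξ - ξ - η / 2 = -ξ - ξ by ring,
    show η / 2 - ξ + ξ - η / 2 = 0 by ring, ← vecMul_vecMul, ← vecMul_vecMul, gaugeRow_gaugeRow_rOp,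
    ← insertSnd_tens]
  simp only [smul_vecMul]
  rw [insertSnd_vecMul_onFst, insertSnd_vecMul_rOp_zero, smul_smul,
    show -ξ - ξ + η = η - 2 * ξ by ring]

/-- The left `R`-matrix is a permutation here, so `U(η/2+ξ)` meets the twist `U(η/2-ξ)` on the same
factors and cancels it up to the scalar `φ`; the other `R`-matrix only intertwines the remaining
product covector. -/
theorem siteState_gaugedRow_lower (hU : Reflection η U) {φ : ℂ} (ψ : ι → ℂ)
    (hφ : U (η / 2 - ξ) * U (η / 2 + ξ) = φ • 1) :
    tens (gaugeRow α η ξ (β - 1)) (siteState α η ξ U β 1 ψ) ᵥ* dress η ξ U (ξ + η / 2) =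
      (Complex.sinh (η + 2 * ξ) * Complex.sinh η * φ) •
        tens (gaugeRow α η (-ξ) (β - 1)) (siteState α η ξ U β 0 ψ) := by
  have h := hU (ξ + η / 2) (η / 2 - ξ)
  rw [show ξ + η / 2 - (η / 2 - ξ) = ξ + η / 2 + ξ - η / 2 by ring,
    show ξ + η / 2 + (η / 2 - ξ) - η = ξ + η / 2 - ξ - η / 2 by ring] at h
  rw [siteState_zero, siteState_one, dress, ← vecMul_vecMul, ← vecMul_vecMul,
    show ξ + η / 2 - ξ - η / 2 = 0 by ring, tens_vecMul_rOp_zero]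
  simp only [smul_vecMul]
  rw [insertSnd_vecMul_onFst, vecMul_vecMul, show ξ + η / 2 = η / 2 + ξ by ring, hφ]
  simp only [vecMul_smul, vecMul_one, insertSnd_smul, insertSnd_tens, smul_vecMul]
  have h2 := gaugeRow_gaugeRow_rOp' α η (-ξ) ξ β ψ
  rw [show η / 2 + ξ + ξ - η / 2 = ξ - -ξ by ring, h2, smul_smul, smul_smul,
    show ξ - -ξ + η = η + 2 * ξ by ring]
  congr 1
  ring

end SiteStates

/-! ### The boundary monodromy matrix as an iterated dressing -/

section Reindex

variable {ι κ : Type*} [Fintype ι] [DecidableEq ι] [Fintype κ] [DecidableEq κ]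

/-- Reindexing of the second factor of `ℂ² ⊗ V`. -/
def auxCongr (e : ι ≃ κ) : Fin 2 × ι ≃ Fin 2 × κ := (Equiv.refl (Fin 2)).prodCongr e

theorem tens_comp_auxCongr (e : ι ≃ κ) (y : Fin 2 → ℂ) (ψ : κ → ℂ) :
    tens y (ψ ∘ e) = tens y ψ ∘ auxCongr e := rfl

theorem contr_comp_auxCongr (e : ι ≃ κ) (x : Fin 2 → ℂ) (w : Fin 2 × κ → ℂ) :
    contr x (w ∘ auxCongr e) = contr x w ∘ e := rfl

theorem comp_vecMul_submatrix (e : ι ≃ κ) (w : κ → ℂ) (M : Matrix κ κ ℂ) :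
    (w ∘ e) ᵥ* M.submatrix e e = (w ᵥ* M) ∘ e := by
  rw [submatrix_vecMul_equiv, Function.comp_assoc, Equiv.self_comp_symm, Function.comp_id]

theorem Reflection.submatrix {η : ℂ} {U : ℂ → Matrix (Fin 2 × κ) (Fin 2 × κ) ℂ}
    (hU : Reflection η U) (e : ι ≃ κ) :
    Reflection η fun u => (U u).submatrix (auxCongr e) (auxCongr e) := by
  have hr : ∀ u, rOp ι η u = (rOp κ η u).submatrix (auxCongr (auxCongr e)) (auxCongr (auxCongr e)) := by
    intro u
    ext ⟨i, a, x⟩ ⟨j, b, y⟩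
    simp [rOp, auxCongr]
  have h1 : ∀ M : Matrix (Fin 2 × κ) (Fin 2 × κ) ℂ,
      onFst (M.submatrix (auxCongr e) (auxCongr e)) =
        (onFst M).submatrix (auxCongr (auxCongr e)) (auxCongr (auxCongr e)) := fun M => rfl
  have h2 : ∀ M : Matrix (Fin 2 × κ) (Fin 2 × κ) ℂ,
      onSnd (M.submatrix (auxCongr e) (auxCongr e)) =
        (onSnd M).submatrix (auxCongr (auxCongr e)) (auxCongr (auxCongr e)) := fun M => rfl
  intro u v
  simp only [hr, h1, h2, submatrix_mul_equiv, hU u v]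

end Reindex

/-- The configurations of `N + 1` sites: a label of the last site, and labels of the others. -/
def splitLast (N : ℕ) : Config (N + 1) ≃ Fin 2 × Config N where
  toFun h := (h (Fin.last N), Fin.init h)
  invFun q := Fin.snoc (α := fun _ => Fin 2) q.2 q.1
  left_inv h := Fin.snoc_init_self h
  right_inv q := by simp

/-- Operators which do not act on the last site. -/
def liftInit {N : ℕ} (X : Op N) : Op (N + 1) :=
  Matrix.of fun s t => if s (Fin.last N) = t (Fin.last N) then X (Fin.init s) (Fin.init t) else 0

theorem liftInit_eq {N : ℕ} (X : Op N) :
    liftInit X = (kroneckerMap (· * ·) (1 : Matrix (Fin 2) (Fin 2) ℂ) X).submatrix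
      (splitLast N) (splitLast N) := by
  ext s t
  simp [liftInit, splitLast, one_apply]

theorem siteOp_last_eq {N : ℕ} (X : Matrix (Fin 2) (Fin 2) ℂ) :
    siteOp (Fin.last N) X = (kroneckerMap (· * ·) X (1 : Op N)).submatrix
      (splitLast N) (splitLast N) := by
  ext s t
  have h : (∀ m, m ≠ Fin.last N → s m = t m) ↔ Fin.init s = Fin.init t := by
    constructor
    · intro h
      ext m
      simp [Fin.init, h m.castSucc (Fin.castSucc_ne_last m)]
    · intro h m hm
      obtain ⟨m, rfl⟩ := Fin.exists_castSucc_eq.2 hm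
      exact congrFun h m
  simp [siteOp, splitLast, one_apply, h]

theorem liftInit_mul {N : ℕ} (X Y : Op N) : liftInit (X * Y) = liftInit X * liftInit Y := by
  simp only [liftInit_eq, submatrix_mul_equiv, ← mul_kronecker_mul, one_mul]

theorem liftInit_add {N : ℕ} (X Y : Op N) : liftInit (X + Y) = liftInit X + liftInit Y := by
  ext s t
  simp only [liftInit, of_apply, Matrix.add_apply]
  split_ifs <;> simp

theorem liftInit_smul {N : ℕ} (c : ℂ) (X : Op N) : liftInit (c • X) = c • liftInit X := by
  ext s t
  simp only [liftInit, of_apply, Matrix.smul_apply]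
  split_ifs <;> simp

theorem liftInit_one {N : ℕ} : liftInit (1 : Op N) = 1 := by
  rw [liftInit_eq, kroneckerMap_one_one _ (by simp) (by simp) (by simp), submatrix_one_equiv]

theorem liftInit_zero {N : ℕ} : liftInit (0 : Op N) = 0 := by
  simpa using liftInit_smul 0 (0 : Op N)

/-- `liftInit` as a ring homomorphism. -/
def liftInitHom (N : ℕ) : Op N →+* Op (N + 1) where
  toFun := liftInit
  map_one' := liftInit_one
  map_mul' := liftInit_mul
  map_zero' := liftInit_zero
  map_add' := liftInit_add

theorem liftInit_siteOp {N : ℕ} (n : Fin N) (X : Matrix (Fin 2) (Fin 2) ℂ) :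
    liftInit (siteOp n X) = siteOp n.castSucc X := by
  ext s t
  have h : (∀ m, m ≠ n.castSucc → s m = t m) ↔
      (∀ m, m ≠ n → Fin.init s m = Fin.init t m) ∧ s (Fin.last N) = t (Fin.last N) := by
    rw [Fin.forall_fin_succ']
    simp [Fin.init, (Fin.castSucc_lt_last n).ne']
  simp only [liftInit, siteOp, of_apply]
  rw [if_congr h rfl rfl]
  by_cases h1 : s (Fin.last N) = t (Fin.last N)
  · simp only [h1, and_true, if_true]
    rfl
  · simp only [h1, and_false, if_false]

theorem siteOp_last_comm_liftInit {N : ℕ} (X : Matrix (Fin 2) (Fin 2) ℂ) (Y : Op N) :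
    siteOp (Fin.last N) X * liftInit Y = liftInit Y * siteOp (Fin.last N) X := by
  simp only [liftInit_eq, siteOp_last_eq, submatrix_mul_equiv, ← mul_kronecker_mul, one_mul, mul_one]

theorem siteOp_last_mul_liftInit_mul_siteOp_last {N : ℕ} (X Z : Matrix (Fin 2) (Fin 2) ℂ)
    (Y : Op N) (s t : Config (N + 1)) :
    (siteOp (Fin.last N) X * liftInit Y * siteOp (Fin.last N) Z) s t =
      (X * Z) (s (Fin.last N)) (t (Fin.last N)) * Y (Fin.init s) (Fin.init t) := by
  simp only [liftInit_eq, siteOp_last_eq, submatrix_mul_equiv, ← mul_kronecker_mul, one_mul, mul_one]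
  rfl

theorem auxLift_mul (N : ℕ) (X Y : Matrix (Fin 2) (Fin 2) ℂ) :
    auxLift N (X * Y) = auxLift N X * auxLift N Y := by
  ext1 i j
  simp [auxLift, mul_apply, add_smul, mul_smul, smul_comm (X i _)]

theorem auxLift_one (N : ℕ) : auxLift N 1 = 1 := by
  ext1 i j
  fin_cases i <;> fin_cases j <;> simp [auxLift]

theorem map_liftInit_auxLift {N : ℕ} (X : Matrix (Fin 2) (Fin 2) ℂ) :
    (auxLift N X).map liftInit = auxLift (N + 1) X := by
  ext1 i j
  simp [auxLift, liftInit_smul, liftInit_one]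

theorem map_liftInit_mul {N : ℕ} (A B : Matrix (Fin 2) (Fin 2) (Op N)) :
    (A * B).map liftInit = A.map liftInit * B.map liftInit :=
  Matrix.map_mul (f := liftInitHom N)

theorem map_liftInit_smul {N : ℕ} (c : ℂ) (A : Matrix (Fin 2) (Fin 2) (Op N)) :
    (c • A).map liftInit = c • A.map liftInit := by
  ext1 i j
  simp [liftInit_smul]

theorem pauliY_mul_self : pauliY * pauliY = 1 := by
  ext i j
  fin_cases i <;> fin_cases j <;> simp [pauliY]

namespace Params

/-- The parameters of the chain without the last site. -/
def initSites {N : ℕ} (p : Params (N + 1)) : Params N where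
  ξ n := p.ξ n.castSucc
  η := p.η
  ζ := p.ζ
  κ := p.κ
  τ := p.τ

theorem bulkMonodromy_succ {N : ℕ} (p : Params (N + 1)) (u : ℂ) :
    p.bulkMonodromy u = (rMatrix p.η (u - p.ξ (Fin.last N) - p.η / 2)).map (siteOp (Fin.last N)) *
      (p.initSites.bulkMonodromy u).map liftInit := by
  have h : ∀ l : List (Matrix (Fin 2) (Fin 2) (Op N)),
      l.prod.map liftInit = (l.map fun A => A.map liftInit).prod := by
    intro l
    exact map_list_prod (liftInitHom N).mapMatrix l
  simp only [bulkMonodromy, h, List.map_reverse, List.map_ofFn]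
  rw [List.ofFn_succ', List.concat_eq_append, List.reverse_append, List.reverse_singleton,
    List.singleton_append, List.prod_cons]
  congr 4
  ext n i j : 4
  simp [liftInit_siteOp, initSites]

/-- Crossing symmetry: it rewrites `M̂` as a product of `R`-matrices in the opposite order, each
site using up one sign of `(-1)^N`. -/
theorem rMatrix_crossing (η w : ℂ) (N : ℕ) :
    -(auxLift (N + 1) pauliY * ((rMatrix η (-w - η)).map (siteOp (Fin.last N))).transpose *
      auxLift (N + 1) pauliY) = (rMatrix η w).map (siteOp (Fin.last N)) := by
  have hs : Complex.sinh (-w - η) = -Complex.sinh (w + η) := by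
    rw [← Complex.sinh_neg]; congr 1; ring
  ext i j s t
  fin_cases i <;> fin_cases j <;>
    simp [auxLift, pauliY, mul_apply, Fin.sum_univ_two, rMatrix, siteOp]
  all_goals
    generalize s (Fin.last N) = a
    generalize t (Fin.last N) = b
    split_ifs
    · fin_cases a <;> fin_cases b <;> simp [hs, ← mul_assoc]
    · simp

/-- Transposition in the auxiliary space reverses the product because the entries at different sites
commute; inserting `σ^y σ^y = 1` between the factors lets crossing act on the new site alone. -/
theorem bulkMonodromyHat_succ {N : ℕ} (p : Params (N + 1)) (u : ℂ) :
    p.bulkMonodromyHat u = (p.initSites.bulkMonodromyHat u).map liftInit *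
      (rMatrix p.η (u + p.ξ (Fin.last N) - p.η / 2)).map (siteOp (Fin.last N)) := by
  rw [← rMatrix_crossing, show -(u + p.ξ (Fin.last N) - p.η / 2) - p.η =
    -u - p.ξ (Fin.last N) - p.η / 2 by ring]
  simp only [bulkMonodromyHat, bulkMonodromy_succ, map_liftInit_smul, map_liftInit_mul,
    map_liftInit_auxLift]
  set A := rMatrix p.η (-u - p.ξ (Fin.last N) - p.η / 2)
  set B := p.initSites.bulkMonodromy (-u)
  have ht : (A.map (siteOp (Fin.last N)) * B.map liftInit).transpose =
      (B.transpose.map liftInit) * (A.map (siteOp (Fin.last N))).transpose := by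
    ext1 i j
    simp [mul_apply, Fin.sum_univ_two, siteOp_last_comm_liftInit]
  have hY : auxLift (N + 1) pauliY * auxLift (N + 1) pauliY = 1 := by
    rw [← auxLift_mul, pauliY_mul_self, auxLift_one]
  rw [ht, pow_succ, mul_neg_one, neg_smul, mul_neg, Matrix.smul_mul]
  have hA : ∀ b a y : Matrix (Fin 2) (Fin 2) (Op (N + 1)), y * y = 1 →
      y * (b * a) * y = y * b * y * (y * a * y) := by
    intro b a y hy
    calc y * (b * a) * y = y * b * (y * y) * a * y := by rw [hy]; simp only [mul_assoc, one_mul]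
      _ = _ := by simp only [mul_assoc]
  rw [hA _ _ _ hY]

theorem boundaryMonodromy_succ {N : ℕ} (p : Params (N + 1)) (u : ℂ) :
    p.boundaryMonodromy u =
      (rMatrix p.η (u - p.ξ (Fin.last N) - p.η / 2)).map (siteOp (Fin.last N)) *
      (p.initSites.boundaryMonodromy u).map liftInit *
      (rMatrix p.η (u + p.ξ (Fin.last N) - p.η / 2)).map (siteOp (Fin.last N)) := by
  simp only [boundaryMonodromy, bulkMonodromyHat_succ, bulkMonodromy_succ, map_liftInit_mul,
    map_liftInit_auxLift, mul_assoc]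
  rfl

/-- The boundary monodromy matrix, as an operator on `ℂ² ⊗ (ℂ²)^{⊗ N}`. -/
def chain {N : ℕ} (p : Params N) (u : ℂ) : Matrix (Fin 2 × Config N) (Fin 2 × Config N) ℂ :=
  Matrix.of fun a b => p.boundaryMonodromy u a.1 b.1 a.2 b.2

theorem chain_succ {N : ℕ} (p : Params (N + 1)) (u : ℂ) :
    p.chain u = (dress p.η (p.ξ (Fin.last N)) p.initSites.chain u).submatrix
      (auxCongr (splitLast N)) (auxCongr (splitLast N)) := by
  ext ⟨i, s⟩ ⟨j, t⟩
  simp only [chain, boundaryMonodromy_succ, of_apply]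
  simp only [Matrix.mul_apply (M := _ * _) (N := Matrix.map _ _),
    Matrix.mul_apply (M := Matrix.map _ _) (N := Matrix.map _ _), Fin.sum_univ_two, map_apply]
  simp only [add_mul, Matrix.add_apply, siteOp_last_mul_liftInit_mul_siteOp_last]
  simp [dress, rOp, onFst, mul_apply, Fintype.sum_prod_type, auxCongr, splitLast, chain]
  ring

theorem chain_zero (p : Params 0) (u : ℂ) (i j : Fin 2) (s t : Config 0) :
    p.chain u (i, s) (j, t) = p.kMinus u i j := by
  have hs : s = t := Subsingleton.elim _ _
  have hY : auxLift 0 pauliY * auxLift 0 pauliY = 1 := by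
    rw [← auxLift_mul, pauliY_mul_self, auxLift_one]
  simp [chain, boundaryMonodromy, bulkMonodromyHat, bulkMonodromy, hY]
  simp [auxLift, hs]

end Params

theorem smul_one_submatrix {ι κ : Type*} [DecidableEq ι] [DecidableEq κ] (e : ι ≃ κ) (c : ℂ) :
    (c • (1 : Matrix κ κ ℂ)).submatrix e e = c • 1 := by
  ext x y
  simp [one_apply]

/-- Contraction with `x` annihilates every `tens z (ψ h)` and sends `w h` to a nonzero multiple of
`ψ' h`, so the coefficients of the `w h` vanish. Those of `tens z (ψ h)` are then read off from the
component `0`, where `z 0 ≠ 0`. -/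
theorem linearIndependent_siteStates {ι H : Type*} [Fintype H] {z x : Fin 2 → ℂ}
    (hz : z 0 ≠ 0) (hzx : ∑ i, z i * x i = 0) {ψ ψ' : H → ι → ℂ} {w : H → Fin 2 × ι → ℂ} {e : H → ℂ}
    (he : ∀ h, e h ≠ 0) (hw : ∀ h, contr x (w h) = e h • ψ' h)
    (hψ : LinearIndependent ℂ ψ) (hψ' : LinearIndependent ℂ ψ') :
    LinearIndependent ℂ fun q : Fin 2 × H => if q.1 = 0 then tens z (ψ q.2) else w q.2 := by
  rw [Fintype.linearIndependent_iff] at hψ hψ' ⊢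
  intro g hg
  simp only [Fintype.sum_prod_type, Fin.sum_univ_two, if_true, one_ne_zero, if_false] at hg
  have h1 : ∀ h, g (1, h) * e h = 0 := by
    apply hψ' fun h => g (1, h) * e h
    ext s
    have h2 : ∑ i, (∑ h, g (0, h) • tens z (ψ h) + ∑ h, g (1, h) • w h) (i, s) * x i = 0 := by
      rw [hg]
      simp
    have h3 : ∀ h, ∑ i, w h (i, s) * x i = e h * ψ' h s := fun h => congrFun (hw h) s
    simp only [Fin.sum_univ_two, Pi.add_apply, Finset.sum_apply, Pi.smul_apply, smul_eq_mul, tens]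
      at h2 h3 hzx ⊢
    simp only [mul_assoc, ← h3, mul_add, Finset.sum_add_distrib, Pi.zero_apply]
    simp only [add_mul, Finset.sum_mul] at h2
    have h4 : ∑ h, g (0, h) * (z 0 * ψ h s) * x 0 + ∑ h, g (0, h) * (z 1 * ψ h s) * x 1 = 0 := by
      rw [← Finset.sum_add_distrib]
      refine Finset.sum_eq_zero fun h _ => ?_
      linear_combination g (0, h) * ψ h s * hzx
    simp only [mul_assoc] at h2 h4
    linear_combination h2 - h4
  have h1' : ∀ h, g (1, h) = 0 := fun h => (mul_eq_zero.1 (h1 h)).resolve_right (he h)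
  have h0 : ∀ h, g (0, h) = 0 := by
    apply hψ
    ext s
    have h2 := congrFun hg (0, s)
    simp only [h1', Pi.add_apply, Finset.sum_apply, Pi.smul_apply, smul_eq_mul, tens, zero_mul,
      Finset.sum_const_zero, add_zero, Pi.zero_apply] at h2 ⊢
    simp only [mul_left_comm _ (z 0), ← Finset.mul_sum] at h2
    exact (mul_eq_zero.1 h2).resolve_left hz
  rintro ⟨i, h⟩
  fin_cases i
  exacts [h0 h, h1' h]

/-! ### Reflection equation, unitarity and pseudo-eigenstates of the chain -/

namespace Params

theorem kMinus_add_half {N : ℕ} (p : Params N) (u : ℂ) :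
    p.kMinus (p.η / 2 + u) = (Complex.sinh p.ζ)⁻¹ •
      !![Complex.sinh (u + p.ζ), p.κ * Complex.exp p.τ * Complex.sinh (2 * u);
        p.κ * Complex.exp (-p.τ) * Complex.sinh (2 * u), Complex.sinh (p.ζ - u)] := by
  rw [kMinus, one_div, show p.η / 2 + u - p.η / 2 + p.ζ = u + p.ζ by ring,
    show 2 * (p.η / 2 + u) - p.η = 2 * u by ring,
    show p.ζ - (p.η / 2 + u) + p.η / 2 = p.ζ - u by ring]

theorem reflection_chain_zero (p : Params 0) : Reflection p.η p.chain := by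
  intro u v
  -- Centering at `η/2` removes the shift by `η` from the entries of `K₋` and from the arguments of
  -- `R`.
  obtain ⟨a, rfl⟩ : ∃ a, u = p.η / 2 + a := ⟨u - p.η / 2, by ring⟩
  obtain ⟨b, rfl⟩ : ∃ b, v = p.η / 2 + b := ⟨v - p.η / 2, by ring⟩
  rw [show p.η / 2 + a - (p.η / 2 + b) = a - b by ring,
    show p.η / 2 + a + (p.η / 2 + b) - p.η = a + b by ring]
  ext ⟨i, k, x⟩ ⟨j, l, y⟩
  obtain rfl : x = y := Subsingleton.elim _ _
  simp only [mul_apply, Fintype.sum_prod_type, Fin.sum_univ_two, rOp, onFst, onSnd, of_apply,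
    chain_zero, Finset.univ_unique, Finset.sum_singleton, if_true, Subsingleton.elim _ x,
    kMinus_add_half]
  generalize (Complex.sinh p.ζ)⁻¹ = s
  fin_cases i <;> fin_cases k <;> fin_cases j <;> fin_cases l <;> simp [rMatrix] <;> first
    | ring1
    | (simp only [Complex.sinh, Complex.exp_add, Complex.exp_neg, sub_eq_add_neg, two_mul, neg_add]
       field_simp
       ring1)

theorem reflection_chain {N : ℕ} (p : Params N) : Reflection p.η p.chain := by
  induction N with
  | zero => exact p.reflection_chain_zero
  | succ N ih =>
    have h := ((ih p.initSites).dress (p.ξ (Fin.last N))).submatrix (splitLast N)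
    have hc : p.chain = fun u => (dress p.η (p.ξ (Fin.last N)) p.initSites.chain u).submatrix
      (auxCongr (splitLast N)) (auxCongr (splitLast N)) := funext p.chain_succ
    rw [hc]
    exact h

/-- `det K₋(u + η/2)`. -/
def kDet {N : ℕ} (p : Params N) (u : ℂ) : ℂ :=
  (Complex.sinh (u + p.ζ) * Complex.sinh (p.ζ - u) - p.κ ^ 2 * Complex.sinh (2 * u) ^ 2) /
    Complex.sinh p.ζ ^ 2

/-- The scalar `𝒰₋(η/2 - u) 𝒰₋(η/2 + u)`. -/
def unitarityFactor {N : ℕ} (p : Params N) (u : ℂ) : ℂ :=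
  p.kDet u * ∏ m, (Complex.sinh (p.η - u + p.ξ m) * Complex.sinh (p.η + u - p.ξ m) *
    (Complex.sinh (p.η - u - p.ξ m) * Complex.sinh (p.η + u + p.ξ m)))

theorem chain_mul_chain {N : ℕ} (p : Params N) (u : ℂ) :
    p.chain (p.η / 2 - u) * p.chain (p.η / 2 + u) = p.unitarityFactor u • 1 := by
  induction N with
  | zero =>
    ext ⟨i, x⟩ ⟨j, y⟩
    obtain rfl : x = y := Subsingleton.elim _ _
    simp only [mul_apply, Fintype.sum_prod_type, Fin.sum_univ_two, chain_zero, Finset.univ_unique,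
      Finset.sum_singleton]
    have e : Complex.exp p.τ * Complex.exp (-p.τ) = 1 := by rw [← Complex.exp_add]; simp
    rw [sub_eq_add_neg, kMinus_add_half, kMinus_add_half, show p.ζ - -u = u + p.ζ by ring,
      show -u + p.ζ = p.ζ - u by ring, mul_neg, Complex.sinh_neg]
    fin_cases i <;> fin_cases j <;>
      simp [unitarityFactor, kDet, one_apply, div_eq_mul_inv]
    · linear_combination (-(Complex.sinh p.ζ)⁻¹ ^ 2 * p.κ ^ 2 * Complex.sinh (2 * u) ^ 2) * e
    · ring
    · ring
    · linear_combination (-(Complex.sinh p.ζ)⁻¹ ^ 2 * p.κ ^ 2 * Complex.sinh (2 * u) ^ 2) * e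
  | succ N ih =>
    have h := ih p.initSites
    have h2 : p.initSites.chain (p.η / 2 - u) * p.initSites.chain (p.η - (p.η / 2 - u)) =
        p.initSites.unitarityFactor u • 1 := by
      rw [show p.η - (p.η / 2 - u) = p.η / 2 + u by ring]
      exact h
    have h3 := dress_mul_dress (ξ := p.ξ (Fin.last N)) h2
    rw [show p.η - (p.η / 2 - u) = p.η / 2 + u by ring] at h3
    rw [chain_succ, chain_succ, submatrix_mul_equiv, h3, smul_one_submatrix]
    congr 1
    rw [unitarityFactor, unitarityFactor, Fin.prod_univ_castSucc]
    simp only [initSites, kDet]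
    rw [show p.η / 2 + (p.η / 2 - u) + p.ξ (Fin.last N) = p.η - u + p.ξ (Fin.last N) by ring,
      show 3 * p.η / 2 - (p.η / 2 - u) - p.ξ (Fin.last N) = p.η + u - p.ξ (Fin.last N) by ring,
      show p.η / 2 + (p.η / 2 - u) - p.ξ (Fin.last N) = p.η - u - p.ξ (Fin.last N) by ring,
      show 3 * p.η / 2 - (p.η / 2 - u) + p.ξ (Fin.last N) = p.η + u + p.ξ (Fin.last N) by ring]
    ring

/-- The left states of the separation of variables, normalized in such a way that they make sense
for all gauge parameters. -/
def sovState : {N : ℕ} → Params N → ℂ → ℂ → Config N → State N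
  | 0, _, _, _, _ => 1
  | N + 1, p, α, β, h => siteState α p.η (p.ξ (Fin.last N)) p.initSites.chain β (h (Fin.last N))
      (sovState p.initSites α (β + 1) (Fin.init h)) ∘ splitLast N

/-- The pseudo-eigenvalue of the (unnormalized) gauged generator `ℬ₋` on `sovState`. -/
def sovEig {N : ℕ} (p : Params N) (α β : ℂ) (h : Config N) (u : ℂ) : ℂ :=
  (∏ n, (Complex.sinh (u - flipSign (h n) (p.ξ n) + p.η / 2) *
    Complex.sinh (u + flipSign (h n) (p.ξ n) - p.η / 2))) *
  (Complex.exp ((N + β - 1 - α) * p.η) * Complex.sinh (2 * u - p.η) *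
    (2 * p.κ * Complex.sinh ((N + β - 1 - α) * p.η - p.τ) - Complex.exp p.ζ) / Complex.sinh p.ζ)

/-- Removing a site raises `β` by one, so `N + β` is constant along the induction; this is why the
boundary factor, computed once from `K₋` at `N = 0`, depends on `N + β` only. Each site contributes
the two hyperbolic sines of its intertwinings. -/
theorem sovState_gaugedB {N : ℕ} (p : Params N) (α β : ℂ) (h : Config N) (u : ℂ) :
    contr (gaugeCol α p.η (p.η / 2 - u) (β - 1))
      (tens (gaugeRow α p.η (u - p.η / 2) (β - 1)) (p.sovState α β h) ᵥ* p.chain u) =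
      p.sovEig α β h u • p.sovState α (β - 2) h := by
  induction N generalizing β with
  | zero =>
    obtain ⟨a, rfl⟩ : ∃ a, u = p.η / 2 + a := ⟨u - p.η / 2, by ring⟩
    rw [show p.η / 2 + a - p.η / 2 = a by ring, show p.η / 2 - (p.η / 2 + a) = -a by ring]
    ext s
    simp only [contr, tens, vecMul, dotProduct, Fintype.sum_prod_type, Fin.sum_univ_two, chain_zero,
      Finset.univ_unique, Finset.sum_singleton, sovState, sovEig, kMinus_add_half]
    rw [show 2 * (p.η / 2 + a) - p.η = 2 * a by ring, show ((0 : ℕ) : ℂ) + β - 1 - α = -(α - (β - 1)) by simp]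
    simp only [div_eq_mul_inv _ (Complex.sinh p.ζ)]
    generalize (Complex.sinh p.ζ)⁻¹ = s
    simp [gaugeRow, gaugeCol, -neg_sub]
    generalize (α - (β - 1)) * p.η = z
    simp only [Complex.sinh, Complex.exp_add, Complex.exp_neg, sub_eq_add_neg, two_mul, neg_add, neg_neg]
    field_simp
    ring
  | succ N ih =>
    have h1 := ih p.initSites (β + 1) (Fin.init h)
    rw [add_sub_cancel_right] at h1
    have h2 := siteState_gaugedB (ξ := p.ξ (Fin.last N)) p.initSites.reflection_chain
      (h (Fin.last N)) h1
    rw [show β + 1 - 2 = β - 2 + 1 by ring] at h2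
    rw [chain_succ, sovState, sovState, tens_comp_auxCongr, comp_vecMul_submatrix,
      contr_comp_auxCongr]
    erw [h2]
    rw [sovEig, sovEig, Fin.prod_univ_castSucc]
    simp only [initSites, Fin.init]
    push_cast
    rw [show (N : ℂ) + (β + 1) - 1 - α = N + 1 + β - 1 - α by ring]
    ext s
    simp only [Pi.smul_apply, Function.comp, smul_eq_mul]
    ring

end Params

/-! ### Raising and lowering of labels; linear independence -/

namespace Params

/-- In the state `sovState p α β h`, the row `gaugeRow * 𝒰₋(u)` of gauged generators has rank one, and is
given by `k` times the state with labels `h'`. -/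
def GaugedRow {N : ℕ} (p : Params N) (α β u : ℂ) (h h' : Config N) (k : ℂ) : Prop :=
  tens (gaugeRow α p.η (u - p.η / 2) (β - 1)) (p.sovState α β h) ᵥ* p.chain u =
    k • tens (gaugeRow α p.η (p.η / 2 - u) (β - 1)) (p.sovState α β h')

theorem gaugedRow_succ_iff {N : ℕ} (p : Params (N + 1)) (α β u : ℂ) (h h' : Config (N + 1)) (k : ℂ) :
    p.GaugedRow α β u h h' k ↔
      tens (gaugeRow α p.η (u - p.η / 2) (β - 1))
        (siteState α p.η (p.ξ (Fin.last N)) p.initSites.chain β (h (Fin.last N))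
          (p.initSites.sovState α (β + 1) (Fin.init h))) ᵥ*
        dress p.η (p.ξ (Fin.last N)) p.initSites.chain u =
      k • tens (gaugeRow α p.η (p.η / 2 - u) (β - 1))
        (siteState α p.η (p.ξ (Fin.last N)) p.initSites.chain β (h' (Fin.last N))
          (p.initSites.sovState α (β + 1) (Fin.init h'))) := by
  rw [GaugedRow, chain_succ, sovState, sovState, tens_comp_auxCongr, comp_vecMul_submatrix,
    tens_comp_auxCongr]
  have H : Function.Injective fun w : Fin 2 × Fin 2 × Config N → ℂ => w ∘ auxCongr (splitLast N) :=
    (auxCongr (splitLast N)).surjective.injective_comp_right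
  exact H.eq_iff (b := k • _)

theorem GaugedRow.succ {N : ℕ} {p : Params (N + 1)} {α β u k : ℂ} {h h' : Config (N + 1)}
    (hk : p.initSites.GaugedRow α (β + 1) u (Fin.init h) (Fin.init h') k)
    (hl : h (Fin.last N) = h' (Fin.last N)) :
    p.GaugedRow α β u h h' (Complex.sinh (u - p.ξ (Fin.last N) + p.η / 2) *
      Complex.sinh (u + p.ξ (Fin.last N) + p.η / 2) * k) := by
  rw [gaugedRow_succ_iff, ← hl]
  rw [GaugedRow, add_sub_cancel_right] at hk
  exact siteState_gaugedRow p.initSites.reflection_chain _ hk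

theorem gaugedRow_zero {N : ℕ} (p : Params N) (α β : ℂ) (h h' : Config N) (n : Fin N) :
    p.GaugedRow α β (flipSign (h n) (p.ξ n) - p.η / 2) h h' 0 := by
  -- With coefficient `0` the target labels are immaterial, which lets the induction keep `h' = h`.
  suffices H : p.GaugedRow α β (flipSign (h n) (p.ξ n) - p.η / 2) h h 0 by
    rw [GaugedRow, zero_smul] at H ⊢
    exact H
  induction N generalizing β with
  | zero => exact n.elim0
  | succ N ih =>
    induction n using Fin.lastCases with
    | last =>
      rw [gaugedRow_succ_iff, zero_smul]
      exact siteState_gaugedRow_eq_zero p.initSites.reflection_chain _ _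
    | cast n =>
      have := GaugedRow.succ (ih p.initSites (β + 1) (Fin.init h) (Fin.init h) n) rfl
      rwa [mul_zero] at this

/-- The coefficient with which the gauged row at `η/2 - ξₙ` raises the label `n`. -/
def raiseCoef {N : ℕ} (p : Params N) (n : Fin N) : ℂ :=
  Complex.sinh (p.η - 2 * p.ξ n) * Complex.sinh p.η *
    ∏ m, if n < m then Complex.sinh (p.η - p.ξ n - p.ξ m) * Complex.sinh (p.η - p.ξ n + p.ξ m) else 1

/-- The coefficient with which the gauged row at `ξₙ + η/2` lowers the label `n`. -/
def lowerCoef {N : ℕ} (p : Params N) (n : Fin N) : ℂ :=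
  Complex.sinh (p.η + 2 * p.ξ n) * Complex.sinh p.η * p.kDet (p.ξ n) *
    ∏ m, if n < m then Complex.sinh (p.η + p.ξ n - p.ξ m) * Complex.sinh (p.η + p.ξ n + p.ξ m)
      else if m < n then
        Complex.sinh (p.η - p.ξ n + p.ξ m) * Complex.sinh (p.η + p.ξ n - p.ξ m) *
        (Complex.sinh (p.η - p.ξ n - p.ξ m) * Complex.sinh (p.η + p.ξ n + p.ξ m))
      else 1

/-- The label is switched when site `n` is the last one; each later site passes the rank-one row on
with its two hyperbolic sines, and earlier sites are part of the inner chain and leave no factor. -/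
theorem gaugedRow_raise {N : ℕ} (p : Params N) (α β : ℂ) (h : Config N) (n : Fin N) (hn : h n = 0) :
    p.GaugedRow α β (p.η / 2 - p.ξ n) h (Function.update h n 1) (p.raiseCoef n) := by
  induction N generalizing β with
  | zero => exact n.elim0
  | succ N ih =>
    induction n using Fin.lastCases with
    | last =>
      have hp : p.raiseCoef (Fin.last N) =
          Complex.sinh (p.η - 2 * p.ξ (Fin.last N)) * Complex.sinh p.η := by
        rw [raiseCoef, Finset.prod_eq_one, mul_one]
        intro m _
        rw [if_neg (Fin.le_last m).not_gt]
      rw [gaugedRow_succ_iff, hn, Function.update_self, Fin.init_update_last, hp,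
        show p.η / 2 - p.ξ (Fin.last N) - p.η / 2 = -p.ξ (Fin.last N) by ring,
        show p.η / 2 - (p.η / 2 - p.ξ (Fin.last N)) = p.ξ (Fin.last N) by ring]
      exact siteState_gaugedRow_raise _
    | cast n =>
      have h1 := ih p.initSites (β + 1) (Fin.init h) n hn
      rw [← Fin.init_update_castSucc] at h1
      have h2 := GaugedRow.succ h1 (by simp [(Fin.castSucc_lt_last n).ne'])
      have hk : p.raiseCoef n.castSucc = Complex.sinh (p.η / 2 - p.ξ n.castSucc - p.ξ (Fin.last N) + p.η / 2) *
          Complex.sinh (p.η / 2 - p.ξ n.castSucc + p.ξ (Fin.last N) + p.η / 2) * p.initSites.raiseCoef n := by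
        rw [raiseCoef, raiseCoef, Fin.prod_univ_castSucc, if_pos (Fin.castSucc_lt_last n)]
        simp only [initSites, Fin.castSucc_lt_castSucc_iff]
        rw [show p.η / 2 - p.ξ n.castSucc - p.ξ (Fin.last N) + p.η / 2 =
          p.η - p.ξ n.castSucc - p.ξ (Fin.last N) by ring,
          show p.η / 2 - p.ξ n.castSucc + p.ξ (Fin.last N) + p.η / 2 =
          p.η - p.ξ n.castSucc + p.ξ (Fin.last N) by ring]
        ring
      rw [hk]
      exact h2

theorem gaugedRow_lower {N : ℕ} (p : Params N) (α β : ℂ) (h : Config N) (n : Fin N) (hn : h n = 1) :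
    p.GaugedRow α β (p.ξ n + p.η / 2) h (Function.update h n 0) (p.lowerCoef n) := by
  induction N generalizing β with
  | zero => exact n.elim0
  | succ N ih =>
    induction n using Fin.lastCases with
    | last =>
      -- The sites before `n` enter through the unitarity scalar of the chain they form, in contrast
      -- with `raiseCoef`.
      have hp : p.lowerCoef (Fin.last N) =
          Complex.sinh (p.η + 2 * p.ξ (Fin.last N)) * Complex.sinh p.η *
            p.initSites.unitarityFactor (p.ξ (Fin.last N)) := by
        rw [lowerCoef, Fin.prod_univ_castSucc, unitarityFactor]
        simp only [Fin.castSucc_lt_last, if_true, lt_irrefl, if_false, mul_one,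
          (Fin.castSucc_lt_last _).not_gt, initSites, kDet]
        ring
      rw [gaugedRow_succ_iff, hn, Function.update_self, Fin.init_update_last, hp,
        show p.ξ (Fin.last N) + p.η / 2 - p.η / 2 = p.ξ (Fin.last N) by ring,
        show p.η / 2 - (p.ξ (Fin.last N) + p.η / 2) = -p.ξ (Fin.last N) by ring]
      exact siteState_gaugedRow_lower p.initSites.reflection_chain _
        (p.initSites.chain_mul_chain (p.ξ (Fin.last N)))
    | cast n =>
      have h1 := ih p.initSites (β + 1) (Fin.init h) n hn
      rw [← Fin.init_update_castSucc] at h1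
      have h2 := GaugedRow.succ h1 (by simp [(Fin.castSucc_lt_last n).ne'])
      have hk : p.lowerCoef n.castSucc = Complex.sinh (p.ξ n.castSucc + p.η / 2 - p.ξ (Fin.last N) + p.η / 2) *
          Complex.sinh (p.ξ n.castSucc + p.η / 2 + p.ξ (Fin.last N) + p.η / 2) * p.initSites.lowerCoef n := by
        rw [lowerCoef, lowerCoef, Fin.prod_univ_castSucc, if_pos (Fin.castSucc_lt_last n)]
        simp only [initSites, Fin.castSucc_lt_castSucc_iff, kDet]
        rw [show p.ξ n.castSucc + p.η / 2 - p.ξ (Fin.last N) + p.η / 2 =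
          p.η + p.ξ n.castSucc - p.ξ (Fin.last N) by ring,
          show p.ξ n.castSucc + p.η / 2 + p.ξ (Fin.last N) + p.η / 2 =
          p.η + p.ξ n.castSucc + p.ξ (Fin.last N) by ring]
        ring
      rw [hk]
      exact h2

/-- Genericity of the inhomogeneities, in terms of hyperbolic sines. -/
structure SinhGeneric {N : ℕ} (p : Params N) : Prop where
  sub : ∀ a b, a ≠ b → Complex.sinh (p.ξ a - p.ξ b) ≠ 0
  sub_eta : ∀ a b, a ≠ b → Complex.sinh (p.η - p.ξ a + p.ξ b) ≠ 0
  add : ∀ a b, Complex.sinh (p.ξ a + p.ξ b) ≠ 0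
  add_eta : ∀ a b, Complex.sinh (p.η + p.ξ a + p.ξ b) ≠ 0
  add_neg_eta : ∀ a b, Complex.sinh (p.η - p.ξ a - p.ξ b) ≠ 0

theorem SinhGeneric.initSites {N : ℕ} {p : Params (N + 1)} (hp : p.SinhGeneric) :
    p.initSites.SinhGeneric where
  sub a b h := hp.sub a.castSucc b.castSucc (by simpa using h)
  sub_eta a b h := hp.sub_eta a.castSucc b.castSucc (by simpa using h)
  add a b := hp.add a.castSucc b.castSucc
  add_eta a b := hp.add_eta a.castSucc b.castSucc
  add_neg_eta a b := hp.add_neg_eta a.castSucc b.castSucc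

/-- The condition that the generator `ℬ₋` at the gauge parameter `β` does not vanish from the left. -/
def NonNilp {N : ℕ} (p : Params N) (α β : ℂ) : Prop :=
  2 * p.κ * Complex.sinh ((N + β - 1 - α) * p.η - p.τ) - Complex.exp p.ζ ≠ 0

/-- The contracted label 1 states are images under the unnormalized `ℬ₋` of the shorter chain at `u
= η/2 - ξ`, hence multiples of its states at `β-1`, while the label 0 states involve its states at
`β+1`. The two families use the conditions with indices `j` and `j+1`; index `0` makes the multiples
nonzero, together with genericity of `ξ`. -/
theorem linearIndependent_sovState {N : ℕ} (p : Params N) (hζ : Complex.sinh p.ζ ≠ 0)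
    (hp : p.SinhGeneric) (α β : ℂ) (hβ : ∀ j : ℕ, j < N → p.NonNilp α (β - 2 * j)) :
    LinearIndependent ℂ (p.sovState α β) := by
  induction N generalizing β with
  | zero =>
    have : p.sovState α β = fun _ => 1 := rfl
    rw [this]
    exact LinearIndependent.of_subsingleton default one_ne_zero
  | succ N ih =>
    have h0 := ih p.initSites hζ hp.initSites (β + 1) fun j hj => by
      have := hβ j (by omega)
      simp only [NonNilp, Params.initSites] at this ⊢
      push_cast at this
      rwa [show (N : ℂ) + (β + 1 - 2 * j) - 1 - α = N + 1 + (β - 2 * j) - 1 - α by ring]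
    have h1 := ih p.initSites hζ hp.initSites (β - 1) fun j hj => by
      have := hβ (j + 1) (by omega)
      simp only [NonNilp, Params.initSites] at this ⊢
      push_cast at this
      rwa [show (N : ℂ) + (β - 1 - 2 * j) - 1 - α = N + 1 + (β - 2 * (j + 1)) - 1 - α by ring]
    set ξ := p.ξ (Fin.last N) with hξ
    have hw : ∀ h, contr (gaugeCol α p.η ξ β)
        (siteState α p.η ξ p.initSites.chain β 1 (p.initSites.sovState α (β + 1) h)) =
        p.initSites.sovEig α (β + 1) h (p.η / 2 - ξ) • p.initSites.sovState α (β - 1) h := by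
      intro h
      have := p.initSites.sovState_gaugedB α (β + 1) h (p.η / 2 - ξ)
      rw [add_sub_cancel_right, show β + 1 - 2 = β - 1 by ring] at this
      rw [siteState_one, ← this]
      simp only [Params.initSites]
      rw [show p.η / 2 - (p.η / 2 - ξ) = ξ by ring, show p.η / 2 - ξ - p.η / 2 = -ξ by ring]
    have he : ∀ h, p.initSites.sovEig α (β + 1) h (p.η / 2 - ξ) ≠ 0 := by
      intro h
      rw [sovEig]
      refine mul_ne_zero (Finset.prod_ne_zero_iff.2 fun n _ => ?_) (div_ne_zero (mul_ne_zero
        (mul_ne_zero (Complex.exp_ne_zero _) ?_) ?_) hζ)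
      · simp only [Params.initSites]
        have hn : n.castSucc ≠ Fin.last N := (Fin.castSucc_lt_last n).ne
        by_cases ha : h n = 0
        · simp only [ha, flipSign, if_true]
          rw [show p.η / 2 - ξ - p.ξ n.castSucc + p.η / 2 = p.η - p.ξ n.castSucc - ξ by ring,
            show p.η / 2 - ξ + p.ξ n.castSucc - p.η / 2 = p.ξ n.castSucc - ξ by ring]
          exact mul_ne_zero (hp.add_neg_eta _ _) (hp.sub _ _ hn)
        · simp only [ha, flipSign, if_false]
          rw [show p.η / 2 - ξ - -p.ξ n.castSucc + p.η / 2 = p.η - ξ + p.ξ n.castSucc by ring,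
            show p.η / 2 - ξ + -p.ξ n.castSucc - p.η / 2 = -(p.ξ n.castSucc + ξ) by ring,
            Complex.sinh_neg]
          exact mul_ne_zero (hp.sub_eta _ _ hn.symm) (neg_ne_zero.2 (hp.add _ _))
      · simp only [Params.initSites]
        rw [show 2 * (p.η / 2 - ξ) - p.η = -(ξ + ξ) by ring, Complex.sinh_neg]
        exact neg_ne_zero.2 (hp.add _ _)
      · have := hβ 0 (by omega)
        simp only [NonNilp, Params.initSites] at this ⊢
        push_cast at this
        rwa [show (N : ℂ) + (β + 1) - 1 - α = N + 1 + (β - 2 * 0) - 1 - α by ring]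
    have hzx : ∑ i, gaugeRow α p.η ξ β i * gaugeCol α p.η ξ β i = 0 := by
      simp [gaugeRow, gaugeCol]
    have key := linearIndependent_siteStates (z := gaugeRow α p.η ξ β) (by simp [gaugeRow]) hzx
      he hw h0 h1
    have h2 := (key.map' (LinearEquiv.funCongrLeft ℂ ℂ (splitLast N)).toLinearMap
      (LinearEquiv.ker _)).comp _ (splitLast N).injective
    refine (show p.sovState α β = fun h => LinearEquiv.funCongrLeft ℂ ℂ (splitLast N)
      (if h (Fin.last N) = 0 then _ else _) from funext fun h => ?_) ▸ h2
    rw [sovState]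
    simp only [splitLast, Equiv.coe_fn_mk]
    by_cases ha : h (Fin.last N) = 0
    · rw [if_pos ha, ha, siteState_zero]
      rfl
    · rw [if_neg ha, Fin.eq_one_of_ne_zero _ ha]
      rfl

end Params

/-! ### The left representation of `ℬ₋` -/

/-- Only the raising rule at label 0 is used, and no site is repeated, so the result does not depend
on the order of the list. No commutation of the operators is needed. -/
theorem vecMul_listProd {N : ℕ} {T : Fin N → Op N} {v : Config N → State N}
    (hT : ∀ h n, h n = 0 → v h ᵥ* T n = v (Function.update h n 1)) (g : Config N) :
    ∀ (l : List (Fin N)), l.Nodup → ∀ k : Config N, (∀ n ∈ l, k n = 0) →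
      v k ᵥ* (l.map fun n => T n ^ (g n : ℕ)).prod = v fun n => if n ∈ l then g n else k n := by
  intro l
  induction l with
  | nil => intro _ k _; simp
  | cons m l ih =>
    intro hl k hk
    obtain ⟨hm, hl⟩ := List.nodup_cons.1 hl
    have hkm : k m = 0 := hk m (by simp)
    have h1 : v k ᵥ* T m ^ (g m : ℕ) = v (Function.update k m (g m)) := by
      by_cases hg : g m = 0
      · rw [hg, ← hkm, Function.update_eq_self, hkm]
        simp
      · rw [Fin.eq_one_of_ne_zero _ hg, ← hT k m hkm]
        simp
    rw [List.map_cons, List.prod_cons, ← vecMul_vecMul, h1, ih hl]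
    · congr 1
      ext1 n
      by_cases hn : n = m
      · subst hn
        simp [hm]
      · simp [hn]
    · intro n hn
      rw [Function.update_of_ne (by rintro rfl; exact hm hn), hk n (by simp [hn])]

theorem prod_pow_update_one {N : ℕ} (f : Fin N → ℂ) (h : Config N) (n : Fin N) (hn : h n = 0) :
    ∏ m, f m ^ (Function.update h n 1 m : ℕ) = (∏ m, f m ^ (h m : ℕ)) * f n := by
  rw [← Finset.mul_prod_erase _ _ (Finset.mem_univ n), ← Finset.mul_prod_erase _ (fun m => f m ^ (h m : ℕ))
    (Finset.mem_univ n), Function.update_self, hn]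
  rw [Finset.prod_congr rfl fun m hm => by rw [Function.update_of_ne (Finset.ne_of_mem_erase hm)]]
  simp [mul_comm]

theorem isBasis_of_linearIndependent {N : ℕ} {v : Config N → State N}
    (hv : LinearIndependent ℂ v) : IsBasis v :=
  ⟨hv, hv.span_eq_top_of_card_eq_finrank' (by simp)⟩

theorem sinh_eq_zero_iff {z : ℂ} : Complex.sinh z = 0 ↔ ∃ m : ℤ, z = m * (Real.pi * Complex.I) := by
  have h1 : Complex.sin (z * Complex.I) = Complex.sinh z * Complex.I := Complex.sin_mul_I z
  have h2 : Complex.sinh z = 0 ↔ Complex.sin (z * Complex.I) = 0 := by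
    rw [h1, mul_eq_zero, or_iff_left Complex.I_ne_zero]
  rw [h2, Complex.sin_eq_zero_iff]
  constructor
  · rintro ⟨k, hk⟩
    refine ⟨-k, ?_⟩
    push_cast
    linear_combination (-Complex.I) * hk + z * Complex.I_mul_I
  · rintro ⟨k, hk⟩
    refine ⟨-k, ?_⟩
    push_cast
    linear_combination Complex.I * hk + (k * Real.pi) * Complex.I_mul_I

namespace Params

variable {N : ℕ} (p : Params N)

theorem Generic.sinhGeneric {p : Params N} (hp : p.Generic) : p.SinhGeneric where
  sub a b h hs := by
    obtain ⟨m, hm⟩ := sinh_eq_zero_iff.1 hs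
    exact (hp a b 0 (by simp) m).1 h (by push_cast; linear_combination hm)
  sub_eta a b h hs := by
    obtain ⟨m, hm⟩ := sinh_eq_zero_iff.1 hs
    exact (hp a b 1 (by simp) (-m)).1 h (by push_cast; linear_combination -hm)
  add a b hs := by
    obtain ⟨m, hm⟩ := sinh_eq_zero_iff.1 hs
    exact (hp a b 0 (by simp) m).2 (by push_cast; linear_combination hm)
  add_eta a b hs := by
    obtain ⟨m, hm⟩ := sinh_eq_zero_iff.1 hs
    exact (hp a b (-1) (by simp) m).2 (by push_cast; linear_combination hm)
  add_neg_eta a b hs := by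
    obtain ⟨m, hm⟩ := sinh_eq_zero_iff.1 hs
    exact (hp a b 1 (by simp) (-m)).2 (by push_cast; linear_combination -hm)

/-- The scalar prefactor cancels the `u`-dependence of the determinant, and the first row becomes
proportional to `gaugeRow` at `β-1`. No condition on `β` is required: if `sinh (β η) = 0`, both
sides vanish by the conventions for inverses and division by zero. -/
theorem exp_smul_gauge_inv (α β u : ℂ) :
    Complex.exp (-u + p.η / 2) • (p.gauge α β (u - p.η / 2))⁻¹ =
      (Complex.exp ((α + 1) * p.η) / (2 * Complex.sinh (β * p.η))) •
        !![-1, Complex.exp (-(u - p.η / 2 + (α - (β - 1)) * p.η));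
          1, -Complex.exp (-(u - p.η / 2 + (α + (β + 1)) * p.η))] := by
  have hd : Complex.exp (-(u - p.η / 2 + (α + (β + 1)) * p.η)) -
      Complex.exp (-(u - p.η / 2 + (α - (β - 1)) * p.η)) =
      -(Complex.exp (-u + p.η / 2) * (Complex.exp ((α + 1) * p.η))⁻¹ *
        (2 * Complex.sinh (β * p.η))) := by
    rw [Complex.sinh, ← Complex.exp_neg]
    rw [show -(u - p.η / 2 + (α + (β + 1)) * p.η) = -u + p.η / 2 + -((α + 1) * p.η) + -(β * p.η) by ring,
      show -(u - p.η / 2 + (α - (β - 1)) * p.η) = -u + p.η / 2 + -((α + 1) * p.η) + β * p.η by ring]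
    simp only [Complex.exp_add]
    ring
  have hE := Complex.exp_ne_zero (-u + p.η / 2)
  have hc : Complex.exp (-u + p.η / 2) * (Complex.exp (-(u - p.η / 2 + (α + (β + 1)) * p.η)) -
      Complex.exp (-(u - p.η / 2 + (α - (β - 1)) * p.η)))⁻¹ =
      -(Complex.exp ((α + 1) * p.η) / (2 * Complex.sinh (β * p.η))) := by
    rw [hd]
    simp only [inv_neg, mul_inv, inv_inv, div_eq_mul_inv]
    field_simp
  rw [gauge, Matrix.inv_def, det_fin_two_of, Ring.inverse_eq_inv', adjugate_fin_two_of, mul_one,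
    mul_one, smul_smul, hc]
  ext i j
  fin_cases i <;> fin_cases j <;> simp

theorem gaugedMonodromy_apply (α β u : ℂ) (i j : Fin 2) (s t : Config N) :
    p.gaugedMonodromy α β u i j s t =
      ∑ k, ∑ l, (Complex.exp (-u + p.η / 2) • (p.gauge α β (u - p.η / 2))⁻¹) i k *
        p.gauge α β (p.η / 2 - u) l j * p.chain u (k, s) (l, t) := by
  simp only [gaugedMonodromy, auxLift, chain, Matrix.smul_apply, Fin.sum_univ_two, of_apply,
    smul_eq_mul]
  rw [Matrix.mul_apply]
  simp only [Fin.sum_univ_two, Matrix.mul_apply (M := Matrix.map _ _), map_apply, Matrix.smul_mul,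
    Matrix.mul_smul, one_mul, mul_one, Matrix.add_apply, Matrix.smul_apply, smul_eq_mul, smul_add]
  ring

theorem vecMul_gaugedMonodromy_zero (α β u : ℂ) (j : Fin 2) (ψ : State N) :
    ψ ᵥ* p.gaugedMonodromy α β u 0 j =
      (Complex.exp ((α + 1) * p.η) / (2 * Complex.sinh (β * p.η))) •
        contr (fun l => p.gauge α β (p.η / 2 - u) l j)
          (tens (gaugeRow α p.η (u - p.η / 2) (β - 1)) ψ ᵥ* p.chain u) := by
  ext t
  simp only [vecMul, dotProduct, gaugedMonodromy_apply, exp_smul_gauge_inv, contr, tens,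
    Fintype.sum_prod_type, Pi.smul_apply, smul_eq_mul, gaugeRow]
  simp only [Fin.sum_univ_two, Finset.sum_mul, Finset.mul_sum, ← Finset.sum_add_distrib]
  refine Finset.sum_congr rfl fun x _ => ?_
  simp only [Matrix.smul_apply, of_apply, cons_val_zero, cons_val_one, cons_val', smul_eq_mul]
  ring

theorem sovState_opB (α β : ℂ) (h : Config N) (u : ℂ) :
    p.sovState α β h ᵥ* p.opB α β u =
      (Complex.exp ((α + 1) * p.η) / (2 * Complex.sinh (β * p.η)) * p.sovEig α β h u) •
        p.sovState α (β - 2) h := by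
  rw [opB, vecMul_gaugedMonodromy_zero, ← smul_smul, ← sovState_gaugedB]
  congr 2
  ext l
  fin_cases l <;> simp [gauge, gaugeCol]

/-- Pairing `gaugeRow` with the first column of the gauge matrix gives a multiple of `2 sinh(βη)`,
which cancels the denominator from the inverse gauge matrix. -/
theorem GaugedRow.opA {p : Params N} {α β u k : ℂ} {h h' : Config N}
    (hk : p.GaugedRow α β u h h' k) (hβ : Complex.sinh (β * p.η) ≠ 0) :
    p.sovState α β h ᵥ* p.opA α (β + 2) u =
      (Complex.exp (u - p.η / 2) * k) • p.sovState α β h' := by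
  rw [Params.opA, add_sub_cancel_right, vecMul_gaugedMonodromy_zero, hk, contr_smul, contr_tens, smul_smul,
    smul_smul]
  congr 1
  rw [Fin.sum_univ_two]
  simp only [gaugeRow, gauge, of_apply, cons_val_zero, cons_val_one]
  rw [show -(p.η / 2 - u + (α + (β + 1)) * p.η) = (u - p.η / 2) + -((α + 1) * p.η) + -(β * p.η) by ring,
    show -(p.η / 2 - u + (α - (β - 1)) * p.η) = (u - p.η / 2) + -((α + 1) * p.η) + β * p.η by ring]
  have h2 : 2 * Complex.sinh (β * p.η) = Complex.exp (β * p.η) - Complex.exp (-(β * p.η)) := by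
    rw [Complex.sinh]; ring
  have h3 : Complex.exp ((α + 1) * p.η) * Complex.exp (-((α + 1) * p.η)) = 1 := by
    rw [← Complex.exp_add]; simp
  simp only [Complex.exp_add _ (-((α + 1) * p.η)), Complex.exp_add _ (β * p.η),
    Complex.exp_add _ (-(β * p.η))]
  have h4 : (2 * Complex.sinh (β * p.η)) ≠ 0 := mul_ne_zero two_ne_zero hβ
  rw [div_mul_eq_mul_div, div_mul_eq_mul_div, div_eq_iff h4, h2]
  linear_combination (Complex.exp (u - p.η / 2) * k * (Complex.exp (β * p.η) -
    Complex.exp (-(β * p.η)))) * h3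

theorem sovState_zero (α β : ℂ) : p.sovState α β 0 = p.leftRef α β := by
  induction N generalizing β with
  | zero =>
    ext s
    simp [sovState, leftRef]
  | succ N ih =>
    have h0 : Fin.init (0 : Config (N + 1)) = 0 := rfl
    ext s
    rw [sovState, Pi.zero_apply, siteState_zero, h0, ih]
    simp only [Function.comp_apply, splitLast, Equiv.coe_fn_mk, tens, leftRef, gaugeRow]
    rw [Fin.prod_univ_castSucc, mul_comm]
    simp only [initSites, Fin.init]
    congr 1
    · refine Finset.prod_congr rfl fun n _ => ?_
      congr 4
      simp only [Fin.val_castSucc]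
      push_cast
      ring
    · congr 3
      simp only [Fin.val_last]
      push_cast
      ring

/-- The normalization factor of the states `leftStateB` with respect to `sovState`. -/
def leftNorm (c : Fin N → ℂ) (h : Config N) : ℂ :=
  ∏ n, (Complex.exp (-p.ξ n) * p.raiseCoef n / c n) ^ (h n : ℕ)

theorem leftNorm_smul_raise {α β : ℂ} {c : Fin N → ℂ} (hc : ∀ n, c n ≠ 0)
    (hβ : Complex.sinh (β * p.η) ≠ 0) (h : Config N) (n : Fin N) (hn : h n = 0) :
    (p.leftNorm c h • p.sovState α β h) ᵥ* p.opA α (β + 2) (p.η / 2 - p.ξ n) =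
      c n • p.leftNorm c (Function.update h n 1) • p.sovState α β (Function.update h n 1) := by
  rw [smul_vecMul, (p.gaugedRow_raise α β h n hn).opA hβ, smul_smul, smul_smul, leftNorm, leftNorm,
    prod_pow_update_one _ _ _ hn]
  congr 1
  rw [show p.η / 2 - p.ξ n - p.η / 2 = -p.ξ n by ring]
  have := hc n
  field_simp

/-- The enumeration `l` is kept arbitrary because the right states lead to the decreasing order. -/
theorem leftRef_vecMul_listProd {α β : ℂ} {c : Fin N → ℂ} (hc : ∀ n, c n ≠ 0)
    (hβ : Complex.sinh (β * p.η) ≠ 0) (h : Config N) {l : List (Fin N)} (hl : l.Nodup)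
    (hl' : ∀ n, n ∈ l) :
    p.leftRef α β ᵥ* (l.map fun n =>
      ((c n)⁻¹ • p.opA α (β + 2) (p.η / 2 - p.ξ n)) ^ (h n : ℕ)).prod =
      p.leftNorm c h • p.sovState α β h := by
  have hT : ∀ h n, h n = 0 → (p.leftNorm c h • p.sovState α β h) ᵥ*
      ((c n)⁻¹ • p.opA α (β + 2) (p.η / 2 - p.ξ n)) =
      p.leftNorm c (Function.update h n 1) • p.sovState α β (Function.update h n 1) := by
    intro h n hn
    rw [vecMul_smul, p.leftNorm_smul_raise hc hβ h n hn, inv_smul_smul₀ (hc n)]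
  have := vecMul_listProd (v := fun h => p.leftNorm c h • p.sovState α β h) hT h l hl 0 (by simp)
  simp only [hl', if_true] at this
  rw [← this, sovState_zero]
  simp [leftNorm]

theorem leftStateB_eq {α β : ℂ} {c : Fin N → ℂ} (hc : ∀ n, c n ≠ 0)
    (hβ : Complex.sinh (β * p.η) ≠ 0) (h : Config N) :
    p.leftStateB α β c h = p.leftNorm c h • p.sovState α β h := by
  rw [← p.leftRef_vecMul_listProd hc hβ h (List.nodup_finRange N) List.mem_finRange, leftStateB,
    leftProduct, List.ofFn_eq_map]

/-- For `m < n` all four hyperbolic sines come from `lowerCoef`; for `n < m` each coefficient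
supplies two. The product is therefore independent of the order of the sites. -/
theorem raiseCoef_mul_lowerCoef (n : Fin N) :
    p.raiseCoef n * p.lowerCoef n = p.kDet (p.ξ n) *
      ((∏ m, Complex.sinh (p.η + p.ξ n - p.ξ m) * Complex.sinh (p.η + p.ξ n + p.ξ m)) *
      ∏ m, Complex.sinh (p.η - p.ξ n - p.ξ m) * Complex.sinh (p.η - p.ξ n + p.ξ m)) := by
  rw [← Finset.prod_mul_distrib, ← Finset.mul_prod_erase _ _ (Finset.mem_univ n), raiseCoef,
    lowerCoef, ← Finset.mul_prod_erase _ _ (Finset.mem_univ n),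
    ← Finset.mul_prod_erase _ (fun m => ite (n < m) _ _) (Finset.mem_univ n)]
  have h : (∏ m ∈ Finset.univ.erase n, (Complex.sinh (p.η + p.ξ n - p.ξ m) *
      Complex.sinh (p.η + p.ξ n + p.ξ m) * (Complex.sinh (p.η - p.ξ n - p.ξ m) *
      Complex.sinh (p.η - p.ξ n + p.ξ m)))) =
      (∏ m ∈ Finset.univ.erase n, if n < m then Complex.sinh (p.η - p.ξ n - p.ξ m) *
        Complex.sinh (p.η - p.ξ n + p.ξ m) else 1) *
      ∏ m ∈ Finset.univ.erase n, if n < m then Complex.sinh (p.η + p.ξ n - p.ξ m) *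
        Complex.sinh (p.η + p.ξ n + p.ξ m)
      else if m < n then
        Complex.sinh (p.η - p.ξ n + p.ξ m) * Complex.sinh (p.η + p.ξ n - p.ξ m) *
        (Complex.sinh (p.η - p.ξ n - p.ξ m) * Complex.sinh (p.η + p.ξ n + p.ξ m))
      else 1 := by
    rw [← Finset.prod_mul_distrib]
    refine Finset.prod_congr rfl fun m hm => ?_
    rcases lt_or_gt_of_ne (Finset.ne_of_mem_erase hm) with hl | hl
    · rw [if_neg hl.not_gt, if_neg hl.not_gt, if_pos hl]
      ring
    · rw [if_pos hl, if_pos hl]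
      ring
  rw [h]
  simp only [lt_irrefl, if_false]
  rw [show p.η + p.ξ n - p.ξ n = p.η by ring, show p.η - p.ξ n + p.ξ n = p.η by ring,
    show p.η + 2 * p.ξ n = p.η + p.ξ n + p.ξ n by ring,
    show p.η - 2 * p.ξ n = p.η - p.ξ n - p.ξ n by ring]
  ring

theorem gMinus_mul_gMinus {αm βm : ℂ} (hζ : Complex.sinh p.ζ ≠ 0) (hκ : p.κ ≠ 0)
    (hb : p.IsBoundaryParam αm βm) (u : ℂ) :
    p.gMinus αm βm (u + p.η / 2) * p.gMinus αm βm (p.η / 2 - u) = p.kDet u := by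
  obtain ⟨h1, h2⟩ := hb
  rw [gMinus, gMinus, kDet, h1, show u + p.η / 2 + αm - p.η / 2 = u + αm by ring,
    show u + p.η / 2 + βm - p.η / 2 = u + βm by ring,
    show p.η / 2 - u + αm - p.η / 2 = αm - u by ring,
    show p.η / 2 - u + βm - p.η / 2 = βm - u by ring]
  field_simp
  have h3 : Complex.sinh p.ζ = 2 * p.κ * (Complex.sinh αm * Complex.cosh βm) := by
    rw [h1]; field_simp
  have h4 : Complex.cosh p.ζ = 2 * p.κ * (Complex.cosh αm * Complex.sinh βm) := by
    rw [h2]; field_simp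
  have e1 := Complex.cosh_sq_sub_sinh_sq αm
  have e2 := Complex.cosh_sq_sub_sinh_sq βm
  have e3 := Complex.cosh_sq_sub_sinh_sq u
  have e4 := Complex.cosh_sq_sub_sinh_sq p.ζ
  rw [mul_comm u 2]
  simp only [Complex.sinh_add, Complex.sinh_sub, Complex.cosh_add, Complex.cosh_sub,
    Complex.sinh_two_mul]
  have k1 : Complex.sinh αm ^ 2 * Complex.cosh u ^ 2 - Complex.cosh αm ^ 2 * Complex.sinh u ^ 2 =
      Complex.sinh αm ^ 2 - Complex.sinh u ^ 2 := by
    linear_combination Complex.sinh αm ^ 2 * e3 - Complex.sinh u ^ 2 * e1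
  have k2 : Complex.cosh βm ^ 2 * Complex.cosh u ^ 2 - Complex.sinh βm ^ 2 * Complex.sinh u ^ 2 =
      Complex.cosh βm ^ 2 + Complex.sinh u ^ 2 := by
    linear_combination Complex.cosh βm ^ 2 * e3 + Complex.sinh u ^ 2 * e2
  -- This is `cosh² ζ - sinh² ζ = 1` expressed through `αm` and `βm`.
  have k3 : 4 * p.κ ^ 2 * (Complex.cosh βm ^ 2 - 1 - Complex.sinh αm ^ 2) = 1 := by
    have e5 := e4
    rw [h3, h4] at e5
    linear_combination e5 - 4 * p.κ ^ 2 * (Complex.sinh βm ^ 2 * e1 - (1 + Complex.sinh αm ^ 2) * e2)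
  linear_combination
    4 * p.κ ^ 2 * (Complex.cosh βm ^ 2 * Complex.cosh u ^ 2 -
      Complex.sinh βm ^ 2 * Complex.sinh u ^ 2) * k1 +
    4 * p.κ ^ 2 * (Complex.sinh αm ^ 2 - Complex.sinh u ^ 2) * k2 +
    Complex.sinh u ^ 2 * e4 - Complex.sinh p.ζ ^ 2 * e3 +
    4 * p.κ ^ 2 * Complex.sinh u ^ 2 * e3 - Complex.sinh u ^ 2 * k3 -
    (Complex.sinh p.ζ + 2 * p.κ * (Complex.sinh αm * Complex.cosh βm)) * h3

theorem raiseCoef_mul_lowerCoef_eq_qDet {αm βm : ℂ} (hζ : Complex.sinh p.ζ ≠ 0) (hκ : p.κ ≠ 0)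
    (hb : p.IsBoundaryParam αm βm) (n : Fin N) :
    p.raiseCoef n * p.lowerCoef n = p.qDet αm βm n := by
  have hs : ∀ x y : ℂ, x = -y → Complex.sinh x = -Complex.sinh y := by
    rintro x y rfl
    exact Complex.sinh_neg y
  have h1 : p.aBulk (p.ξ n + p.η / 2) * p.aBulk (-(p.ξ n + p.η / 2) - p.η) =
      ∏ m, -(Complex.sinh (p.η + p.ξ n - p.ξ m) * Complex.sinh (p.η + p.ξ n + p.ξ m)) := by
    rw [aBulk, aBulk, ← Finset.prod_mul_distrib]
    refine Finset.prod_congr rfl fun m _ => ?_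
    rw [hs (-(p.ξ n + p.η / 2) - p.η - p.ξ m + p.η / 2) (p.η + p.ξ n + p.ξ m) (by ring),
      show p.ξ n + p.η / 2 - p.ξ m + p.η / 2 = p.η + p.ξ n - p.ξ m by ring, mul_neg]
  have h2 : p.aBulk (p.η / 2 - p.ξ n) * p.aBulk (-(p.η / 2 - p.ξ n) - p.η) =
      ∏ m, -(Complex.sinh (p.η - p.ξ n - p.ξ m) * Complex.sinh (p.η - p.ξ n + p.ξ m)) := by
    rw [aBulk, aBulk, ← Finset.prod_mul_distrib]
    refine Finset.prod_congr rfl fun m _ => ?_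
    rw [hs (-(p.η / 2 - p.ξ n) - p.η - p.ξ m + p.η / 2) (p.η - p.ξ n + p.ξ m) (by ring),
      show p.η / 2 - p.ξ n - p.ξ m + p.η / 2 = p.η - p.ξ n - p.ξ m by ring, mul_neg]
  rw [raiseCoef_mul_lowerCoef, ← p.gMinus_mul_gMinus hζ hκ hb, qDet, aMinus, aMinus]
  calc _ = p.gMinus αm βm (p.ξ n + p.η / 2) * p.gMinus αm βm (p.η / 2 - p.ξ n) *
      ((p.aBulk (p.ξ n + p.η / 2) * p.aBulk (-(p.ξ n + p.η / 2) - p.η)) *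
        (p.aBulk (p.η / 2 - p.ξ n) * p.aBulk (-(p.η / 2 - p.ξ n) - p.η))) := by
        rw [h1, h2, ← Finset.prod_mul_distrib, ← Finset.prod_mul_distrib]
        simp only [neg_mul_neg]
    _ = _ := by ring

theorem leftNorm_smul_lower {αm βm : ℂ} (hζ : Complex.sinh p.ζ ≠ 0) (hκ : p.κ ≠ 0)
    (hb : p.IsBoundaryParam αm βm) {α β : ℂ} {c : Fin N → ℂ}
    (hβ : Complex.sinh (β * p.η) ≠ 0) (h : Config N) (n : Fin N) (hn : h n = 1) :
    (p.leftNorm c h • p.sovState α β h) ᵥ* p.opA α (β + 2) (p.ξ n + p.η / 2) =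
      (p.qDet αm βm n / c n) • p.leftNorm c (Function.update h n 0) •
        p.sovState α β (Function.update h n 0) := by
  obtain ⟨k, hk, rfl⟩ : ∃ k : Config N, k n = 0 ∧ h = Function.update k n 1 :=
    ⟨Function.update h n 0, by simp, by simp [← hn]⟩
  have hk' : Function.update (Function.update k n 1) n 0 = k := by simp [← hk]
  rw [smul_vecMul, (p.gaugedRow_lower α β _ n hn).opA hβ, smul_smul, smul_smul, hk', leftNorm, leftNorm,
    prod_pow_update_one _ _ _ hk, ← p.raiseCoef_mul_lowerCoef_eq_qDet hζ hκ hb]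
  congr 1
  rw [show p.ξ n + p.η / 2 - p.η / 2 = p.ξ n by ring]
  have h3 : Complex.exp (-p.ξ n) * Complex.exp (p.ξ n) = 1 := by rw [← Complex.exp_add]; simp
  simp only [div_eq_mul_inv]
  linear_combination ((∏ m, (Complex.exp (-p.ξ m) * p.raiseCoef m * (c m)⁻¹) ^ (k m : ℕ)) *
    p.raiseCoef n * (c n)⁻¹ * p.lowerCoef n) * h3

theorem aH_mul_aH (h : Config N) (u : ℂ) :
    (-1) ^ N * (p.aH h u * p.aH h (-u)) = ∏ n, (Complex.sinh (u - flipSign (h n) (p.ξ n) + p.η / 2) *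
      Complex.sinh (u + flipSign (h n) (p.ξ n) - p.η / 2)) := by
  have h1 : ((-1 : ℂ)) ^ N = ∏ _n : Fin N, (-1 : ℂ) := by simp
  rw [aH, aH, h1, ← Finset.prod_mul_distrib, ← Finset.prod_mul_distrib]
  refine Finset.prod_congr rfl fun n _ => ?_
  have hs : ∀ x y : ℂ, x = -y → Complex.sinh x = -Complex.sinh y := by
    rintro x y rfl
    exact Complex.sinh_neg y
  by_cases hn : h n = 0
  · simp only [hn, flipSign, if_true]
    rw [show u - p.ξ n - (((0 : Fin 2) : ℕ) - 1 / 2) * p.η = u - p.ξ n + p.η / 2 by simp; ring,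
      hs (-u - p.ξ n - (((0 : Fin 2) : ℕ) - 1 / 2) * p.η) (u + p.ξ n - p.η / 2) (by simp; ring)]
    ring
  · rw [Fin.eq_one_of_ne_zero _ hn]
    simp only [flipSign, one_ne_zero, if_false]
    rw [show u - p.ξ n - (((1 : Fin 2) : ℕ) - 1 / 2) * p.η = u + -p.ξ n - p.η / 2 by simp; ring,
      hs (-u - p.ξ n - (((1 : Fin 2) : ℕ) - 1 / 2) * p.η) (u - -p.ξ n + p.η / 2) (by simp; ring)]
    ring

theorem leftNorm_smul_opB {α β : ℂ} {c c' : Fin N → ℂ} (hc : ∀ n, c n ≠ 0) (hc' : ∀ n, c' n ≠ 0)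
    (h : Config N) (u : ℂ) :
    (p.leftNorm c h • p.sovState α β h) ᵥ* p.opB α β u =
      p.leftEig α β c c' h u • p.leftNorm c' h • p.sovState α (β - 2) h := by
  rw [smul_vecMul, sovState_opB, smul_smul, smul_smul]
  congr 1
  have h1 : p.leftNorm c h = (∏ n, (c' n / c n) ^ (h n : ℕ)) * p.leftNorm c' h := by
    rw [leftNorm, leftNorm, ← Finset.prod_mul_distrib]
    refine Finset.prod_congr rfl fun n _ => ?_
    rw [← mul_pow]
    congr 1
    have := hc n
    have := hc' n
    field_simp
  have h2 : Complex.exp ((α + 1) * p.η) * Complex.exp ((N + β - 1 - α) * p.η) =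
      Complex.exp ((β + N) * p.η) := by
    rw [← Complex.exp_add]; congr 1; ring
  rw [h1, sovEig, ← aH_mul_aH, leftEig, ← h2, show (N : ℂ) + β - α - 1 = N + β - 1 - α by ring]
  simp only [div_eq_mul_inv, mul_inv]
  ring

/-- If `h` and `k` differ at site `n`, then `±(ξₙ + (kₙ - 1/2)η)` are zeros of the eigenvalue for
`k`, and genericity keeps both `aH h` factors nonzero there. For `N = 0` there is nothing to
separate, so the boundary factor matters only if `0 < N`. -/
theorem leftEig_simple {α β : ℂ} {c c' : Fin N → ℂ} (hc : ∀ n, c n ≠ 0) (hc' : ∀ n, c' n ≠ 0)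
    (hη : Complex.sinh p.η ≠ 0) (hζ : Complex.sinh p.ζ ≠ 0) (hp : p.SinhGeneric)
    (hβ : Complex.sinh (β * p.η) ≠ 0) (hB : 0 < N → p.NonNilp α β) (h k : Config N) (hhk : h ≠ k)
    (t : ℂ) : p.leftEig α β c c' h ≠ t • p.leftEig α β c c' k := by
  intro H
  obtain ⟨n, hn⟩ : ∃ n, h n ≠ k n := by
    by_contra! H
    exact hhk (funext H)
  have hB := hB n.pos
  have hs : ∀ x y : ℂ, x = -y → Complex.sinh y ≠ 0 → Complex.sinh x ≠ 0 := by
    rintro x y rfl hy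
    rw [Complex.sinh_neg]
    exact neg_ne_zero.2 hy
  have key : ∀ u, p.aH k u * p.aH k (-u) = 0 → p.aH h u ≠ 0 → p.aH h (-u) ≠ 0 →
      Complex.sinh (2 * u - p.η) ≠ 0 → False := by
    intro u h1 h2 h3 h4
    have h5 := congrFun H u
    have h6 : p.leftEig α β c c' k u = 0 := by
      simp only [leftEig]
      linear_combination ((-1) ^ N * Complex.exp ((β + N) * p.η) * (∏ n, (c' n / c n) ^ (k n : ℕ)) *
        (Complex.sinh (2 * u - p.η) *
          (2 * p.κ * Complex.sinh ((N + β - α - 1) * p.η - p.τ) - Complex.exp p.ζ) /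
          (2 * Complex.sinh p.ζ * Complex.sinh (β * p.η)))) * h1
    rw [Pi.smul_apply, h6, smul_zero, leftEig] at h5
    rw [NonNilp, show (N : ℂ) + β - 1 - α = N + β - α - 1 by ring] at hB
    revert h5
    simp [h2, h3, h4, hB, hζ, hβ, Finset.prod_eq_zero_iff, hc, hc']
  have hsub : ∀ a b : Fin 2, ∀ m, (m = n → a ≠ b) →
      Complex.sinh (p.ξ n - p.ξ m + ((a : ℕ) - (b : ℕ)) * p.η) ≠ 0 := by
    intro a b m hm
    by_cases hmn : m = n
    · subst hmn
      have := hm rfl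
      fin_cases a <;> fin_cases b <;> simp_all
    · fin_cases a <;> fin_cases b <;> simp
      · exact hp.sub _ _ (Ne.symm hmn)
      · exact hs _ _ (by ring) (hp.sub_eta n m (Ne.symm hmn))
      · have := hp.sub_eta m n hmn
        rwa [show p.η - p.ξ m + p.ξ n = p.ξ n - p.ξ m + p.η by ring] at this
      · exact hp.sub _ _ (Ne.symm hmn)
  have hadd : ∀ a b : Fin 2, ∀ m,
      Complex.sinh (p.ξ n + p.ξ m + ((a : ℕ) + (b : ℕ) - 1) * p.η) ≠ 0 := by
    intro a b m
    fin_cases a <;> fin_cases b <;> simp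
    · exact hs _ _ (by ring) (hp.add_neg_eta n m)
    · exact hp.add _ _
    · exact hp.add _ _
    · have := hp.add_eta n m
      rwa [show p.η + p.ξ n + p.ξ m = p.ξ n + p.ξ m + p.η by ring] at this
  obtain ⟨v, hv⟩ : ∃ v, v = p.ξ n + (((k n : ℕ) : ℂ) - 1 / 2) * p.η := ⟨_, rfl⟩
  have h1 : p.aH k v = 0 := by
    refine Finset.prod_eq_zero (Finset.mem_univ n) ?_
    rw [show v - p.ξ n - (((k n : ℕ) : ℂ) - 1 / 2) * p.η = 0 by rw [hv]; ring, Complex.sinh_zero]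
  have h2 : p.aH h v ≠ 0 := by
    refine Finset.prod_ne_zero_iff.2 fun m _ => ?_
    have := hsub (k n) (h m) m (by rintro rfl; exact hn.symm)
    rwa [show v - p.ξ m - (((h m : ℕ) : ℂ) - 1 / 2) * p.η =
      p.ξ n - p.ξ m + (((k n : ℕ) : ℂ) - (h m : ℕ)) * p.η by rw [hv]; ring]
  have h3 : p.aH h (-v) ≠ 0 :=
    Finset.prod_ne_zero_iff.2 fun m _ => hs _ _ (by rw [hv]; ring) (hadd (k n) (h m) m)
  -- The sign of the zero is chosen so that `2u - η = ∓2ξₙ`. With the other sign it would be `±2(ξₙ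
  -- ∓ η)` up to the label, where genericity does not exclude a zero of `sinh(2u - η)`.
  by_cases hk : k n = 0
  · refine key (-v) ?_ h3 ?_ ?_
    · rw [neg_neg, h1, mul_zero]
    · rwa [neg_neg]
    · exact hs _ _ (by rw [hv, hk]; simp; ring) (hp.add n n)
  · refine key v ?_ h2 h3 ?_
    · rw [h1, zero_mul]
    · rw [hv, Fin.eq_one_of_ne_zero _ hk]
      exact (by simp; ring : p.ξ n + p.ξ n =
        2 * (p.ξ n + ((((1 : Fin 2) : ℕ) : ℂ) - 1 / 2) * p.η) - p.η) ▸ hp.add n n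

theorem raiseCoef_ne_zero {p : Params N} (hη : Complex.sinh p.η ≠ 0) (hp : p.SinhGeneric)
    (n : Fin N) : p.raiseCoef n ≠ 0 := by
  refine mul_ne_zero (mul_ne_zero ?_ hη) (Finset.prod_ne_zero_iff.2 fun m _ => ?_)
  · have := hp.add_neg_eta n n
    rwa [show p.η - 2 * p.ξ n = p.η - p.ξ n - p.ξ n by ring]
  · split_ifs with h
    · exact mul_ne_zero (hp.add_neg_eta _ _) (hp.sub_eta _ _ h.ne)
    · exact one_ne_zero

theorem leftNorm_ne_zero {p : Params N} (hη : Complex.sinh p.η ≠ 0) (hp : p.SinhGeneric)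
    {c : Fin N → ℂ} (hc : ∀ n, c n ≠ 0) (h : Config N) : p.leftNorm c h ≠ 0 :=
  Finset.prod_ne_zero_iff.2 fun n _ => pow_ne_zero _
    (div_ne_zero (mul_ne_zero (Complex.exp_ne_zero _) (raiseCoef_ne_zero hη hp n)) (hc n))

theorem isBasis_leftStateB {α β : ℂ} {c : Fin N → ℂ} (hη : Complex.sinh p.η ≠ 0)
    (hζ : Complex.sinh p.ζ ≠ 0) (hp : p.SinhGeneric) (hc : ∀ n, c n ≠ 0)
    (hβ : Complex.sinh (β * p.η) ≠ 0) (hB : ∀ j : ℕ, j < N → p.NonNilp α (β - 2 * j)) :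
    IsBasis (p.leftStateB α β c) := by
  apply isBasis_of_linearIndependent
  have h1 := (p.linearIndependent_sovState hζ hp α β hB).units_smul
    fun h => Units.mk0 _ (leftNorm_ne_zero hη hp hc h)
  have h2 : p.leftStateB α β c =
      (fun h => Units.mk0 _ (leftNorm_ne_zero hη hp hc h)) • p.sovState α β := by
    ext1 h
    rw [p.leftStateB_eq hc hβ]
    rfl
  rw [h2]
  exact h1

theorem left_representation {αm βm : ℂ} (hη : Complex.sinh p.η ≠ 0) (hζ : Complex.sinh p.ζ ≠ 0)
    (hκ : p.κ ≠ 0) (hb : p.IsBoundaryParam αm βm) (hp : p.SinhGeneric) {α β : ℂ} {c c' : Fin N → ℂ}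
    (hc : ∀ n, c n ≠ 0) (hc' : ∀ n, c' n ≠ 0) (hβ : Complex.sinh (β * p.η) ≠ 0)
    (hβ' : Complex.sinh ((β - 2) * p.η) ≠ 0) (hB : ∀ j : ℕ, j < N → p.NonNilp α (β - 2 * j)) :
    IsPseudoEigenbasis (leftAct (p.opB α β)) (p.leftStateB α β c) (p.leftStateB α (β - 2) c')
      (p.leftEig α β c c') ∧
    ActsByShifts p (leftAct (p.opA α (β + 2))) (p.leftStateB α β c)
      (fun n => p.qDet αm βm n / c n) c ∧
    (p.NonNilp α (β - 2 * N) → IsBasis (p.leftStateB α (β - 2) c')) := by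
  refine ⟨⟨p.isBasis_leftStateB hη hζ hp hc hβ hB, fun h u => ?_, p.leftEig_simple hc hc' hη hζ hp hβ
    fun hN => by simpa using hB 0 hN⟩, fun h n => ?_, fun hN => ?_⟩
  · rw [p.leftStateB_eq hc hβ, p.leftStateB_eq hc' hβ']
    exact p.leftNorm_smul_opB hc hc' h u
  · have hz : ∀ u, u = flipSign (h n) (p.ξ n) - p.η / 2 →
        p.leftStateB α β c h ᵥ* p.opA α (β + 2) u = 0 := by
      rintro u rfl
      rw [p.leftStateB_eq hc hβ, smul_vecMul, (p.gaugedRow_zero α β h h n).opA hβ]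
      simp
    simp only [leftAct]
    refine ⟨fun hn => ⟨hz _ (by simp [hn, flipSign]), ?_⟩, fun hn => ⟨?_, hz _ ?_⟩⟩
    · rw [neg_sub, p.leftStateB_eq hc hβ, p.leftStateB_eq hc hβ]
      exact p.leftNorm_smul_raise hc hβ h n hn
    · rw [p.leftStateB_eq hc hβ, p.leftStateB_eq hc hβ]
      exact p.leftNorm_smul_lower hζ hκ hb hβ h n hn
    · simp [hn, flipSign]
      ring
  -- At `β - 2` the conditions are those at `β` with `j` replaced by `j + 1`; only `j + 1 = N` is
  -- new, and it is the extra hypothesis.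
  · refine p.isBasis_leftStateB hη hζ hp hc' hβ' fun j hj => ?_
    rcases Nat.lt_or_ge (j + 1) N with h | h
    · have := hB (j + 1) h
      push_cast at this
      rwa [show β - 2 - 2 * (j : ℂ) = β - 2 * (j + 1) by ring]
    · have h' : N = j + 1 := by omega
      have h2 : (N : ℂ) = j + 1 := by rw [h']; push_cast; ring
      rw [h2] at hN
      rwa [show β - 2 - 2 * (j : ℂ) = β - 2 * (j + 1) by ring]

/-- The difference of the two sides factors through `(e^w - e^z)(e^{w+z} + 1)`. The first factor
gives the even `k`, the second the odd ones. -/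
theorem exists_of_sinh_eq_sinh {w z : ℂ} (h : Complex.sinh w = Complex.sinh z) :
    ∃ k : ℤ, w = (-1) ^ k * z - k * (Real.pi * Complex.I) := by
  have hI : Complex.exp (Real.pi * Complex.I) = -1 := Complex.exp_pi_mul_I
  have h1 : (Complex.exp w - Complex.exp z) * (Complex.exp w * Complex.exp z + 1) = 0 := by
    rw [Complex.sinh, Complex.sinh, Complex.exp_neg, Complex.exp_neg] at h
    have := Complex.exp_ne_zero w
    have := Complex.exp_ne_zero z
    field_simp at h
    linear_combination h
  rcases mul_eq_zero.1 h1 with h2 | h2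
  · obtain ⟨n, hn⟩ := Complex.exp_eq_exp_iff_exists_int.1 (sub_eq_zero.1 h2)
    refine ⟨-(n + n), ?_⟩
    rw [Even.neg_one_zpow ⟨-n, by ring⟩, hn]
    push_cast
    ring
  · have h3 : Complex.exp w = Complex.exp (-z + Real.pi * Complex.I) := by
      rw [Complex.exp_add, hI, Complex.exp_neg]
      have := Complex.exp_ne_zero z
      field_simp
      linear_combination h2
    obtain ⟨n, hn⟩ := Complex.exp_eq_exp_iff_exists_int.1 h3
    refine ⟨-(2 * n + 1), ?_⟩
    rw [Odd.neg_one_zpow ⟨-n - 1, by ring⟩, hn]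
    push_cast
    ring

/-- Adding the two defining relations of the boundary parameters gives `sinh(α₋+β₋) = e^ζ/(2κ)`, so
a zero of the boundary factor is an equality of two hyperbolic sines. -/
theorem NonNilpBL.nonNilp {p : Params N} {αm βm α β : ℂ} (hκ : p.κ ≠ 0)
    (hb : p.IsBoundaryParam αm βm) (h : p.NonNilpBL αm βm α β) : p.NonNilp α β := by
  intro h0
  have h1 : Complex.sinh ((N + β - 1 - α) * p.η - p.τ) = Complex.sinh (αm + βm) := by
    rw [Complex.sinh_add, hb.1, hb.2, ← add_div, add_comm (Complex.sinh _), Complex.cosh_add_sinh]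
    field_simp
    linear_combination h0
  obtain ⟨k, hk⟩ := exists_of_sinh_eq_sinh h1
  exact h k (by linear_combination -hk)

theorem NonNilpCL.nonNilpBL {p : Params N} {αm βm α β : ℂ} (h : p.NonNilpCL αm βm α β) :
    p.NonNilpBL αm βm α (2 - β) :=
  fun k hk => h k (by linear_combination hk)

theorem NonNilpCR.nonNilpBR {p : Params N} {αm βm α β : ℂ} (h : p.NonNilpCR αm βm α β) :
    p.NonNilpBR αm βm α (2 - β) :=
  fun k hk => h k (by linear_combination hk)

end Params

/-! ### Transposition: from left states to right states -/

section Transposition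

variable {ι : Type*} [Fintype ι] [DecidableEq ι]

/-- The transpose of `M`, conjugated by the diagonal matrix with entries `ε`. -/
def signTranspose (ε : ι → ℂ) (M : Matrix ι ι ℂ) : Matrix ι ι ℂ :=
  Matrix.of fun a b => ε a * M b a * ε b

/-- The signs of `σᶻ` on the first factor of `ℂ² ⊗ V`, multiplied by the signs `ε`. -/
def auxSign (ε : ι → ℂ) : Fin 2 × ι → ℂ := fun a => (-1) ^ (a.1 : ℕ) * ε a.2

theorem auxSign_mul_self {ε : ι → ℂ} (hε : ∀ a, ε a * ε a = 1) (a : Fin 2 × ι) :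
    auxSign ε a * auxSign ε a = 1 := by
  rw [auxSign, mul_mul_mul_comm, hε, ← mul_pow]
  simp

theorem signTranspose_mul {ε : ι → ℂ} (hε : ∀ a, ε a * ε a = 1) (A B : Matrix ι ι ℂ) :
    signTranspose ε (A * B) = signTranspose ε B * signTranspose ε A := by
  ext a b
  simp only [signTranspose, of_apply, mul_apply, Finset.mul_sum, Finset.sum_mul]
  refine Finset.sum_congr rfl fun c _ => ?_
  linear_combination (-(ε a * A b c * B c a * ε b)) * hε c

/-- `R` is a symmetric matrix and commutes with `σᶻ ⊗ σᶻ`. -/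
theorem signTranspose_rOp {ε : ι → ℂ} (hε : ∀ a, ε a * ε a = 1) (η u : ℂ) :
    signTranspose (auxSign (auxSign ε)) (rOp ι η u) = rOp ι η u := by
  ext ⟨i, a, x⟩ ⟨j, b, y⟩
  by_cases h : x = y
  · subst h
    have := hε x
    simp only [signTranspose, rOp, of_apply, auxSign, if_true]
    fin_cases i <;> fin_cases a <;> fin_cases j <;> fin_cases b <;>
      simp [rMatrix, mul_right_comm, this]
  · simp [signTranspose, rOp, h, Ne.symm h]

theorem signTranspose_onFst (ε : ι → ℂ) (U : Matrix (Fin 2 × ι) (Fin 2 × ι) ℂ) :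
    signTranspose (auxSign (auxSign ε)) (onFst U) = onFst (signTranspose (auxSign ε) U) := by
  ext ⟨i, a, x⟩ ⟨j, b, y⟩
  by_cases h : a = b
  · subst h
    simp only [signTranspose, onFst, of_apply, auxSign, if_true]
    fin_cases a <;> simp
  · simp [signTranspose, onFst, h, Ne.symm h]

/-- Transposition exchanges the left and right `R`-matrices of the site, which amounts to `ξ → -ξ`.
-/
theorem dress_signTranspose {ε : ι → ℂ} (hε : ∀ a, ε a * ε a = 1) (η ξ u : ℂ)
    (U : ℂ → Matrix (Fin 2 × ι) (Fin 2 × ι) ℂ) :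
    dress η (-ξ) (fun u => signTranspose (auxSign ε) (U u)) u =
      signTranspose (auxSign (auxSign ε)) (dress η ξ U u) := by
  have h2 := auxSign_mul_self (auxSign_mul_self hε)
  rw [dress, dress, signTranspose_mul h2, signTranspose_mul h2, signTranspose_onFst,
    signTranspose_rOp hε, signTranspose_rOp hε, mul_assoc, sub_neg_eq_add, ← sub_eq_add_neg]

end Transposition

/-- The signs of `σᶻ ⊗ ⋯ ⊗ σᶻ`. -/
def configSign (N : ℕ) : State N := fun s => ∏ n, (-1) ^ (s n : ℕ)

theorem configSign_mul_self {N : ℕ} (s : Config N) : configSign N s * configSign N s = 1 := by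
  rw [configSign, ← Finset.prod_mul_distrib]
  refine Finset.prod_eq_one fun n _ => ?_
  rw [← mul_pow]
  simp

theorem configSign_succ (N : ℕ) : configSign (N + 1) = auxSign (configSign N) ∘ splitLast N := by
  ext s
  simp only [configSign, auxSign, splitLast, Function.comp_apply, Equiv.coe_fn_mk]
  rw [Fin.prod_univ_castSucc, mul_comm]
  rfl

namespace Params

variable {N : ℕ} (p : Params N)

/-- The parameters of the chain with transposed boundary monodromy matrix. -/
def mirror : Params N where
  ξ n := -p.ξ n
  η := p.η
  ζ := p.ζ
  κ := p.κ
  τ := -p.τ + Real.pi * Complex.I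

/-- On `K₋`, transposition gives `τ → -τ`, and the sign that `σᶻ` puts on the off-diagonal entries
is absorbed by adding `iπ`. -/
theorem mirror_chain {N : ℕ} (p : Params N) (u : ℂ) :
    p.mirror.chain u = signTranspose (auxSign (configSign N)) (p.chain u) := by
  induction N generalizing u with
  | zero =>
    ext ⟨i, s⟩ ⟨j, t⟩
    rw [chain_zero]
    simp only [signTranspose, of_apply, chain_zero, auxSign, configSign, Finset.univ_eq_empty,
      Finset.prod_empty, mul_one]
    fin_cases i <;> fin_cases j <;>
      simp [kMinus, mirror, Complex.exp_add, Complex.exp_neg, Complex.exp_pi_mul_I]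
  | succ N ih =>
    have h1 : p.mirror.initSites = p.initSites.mirror := rfl
    have h2 : p.initSites.mirror.chain =
        fun u => signTranspose (auxSign (configSign N)) (p.initSites.chain u) := funext (ih _)
    rw [chain_succ, chain_succ, h1, h2]
    have h3 := dress_signTranspose (configSign_mul_self (N := N)) p.η (p.ξ (Fin.last N)) u
      p.initSites.chain
    rw [show p.mirror.η = p.η from rfl, show p.mirror.ξ (Fin.last N) = -p.ξ (Fin.last N) from rfl, h3,
      configSign_succ]
    rfl

end Params

section Transposition

variable {ι : Type*} [Fintype ι] [DecidableEq ι] {ε : ι → ℂ}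

theorem signTranspose_pow (hε : ∀ a, ε a * ε a = 1) (A : Matrix ι ι ℂ) (k : ℕ) :
    signTranspose ε (A ^ k) = signTranspose ε A ^ k := by
  induction k with
  | zero =>
    ext a b
    by_cases h : a = b
    · subst h
      simp [signTranspose, hε]
    · simp [signTranspose, h, Ne.symm h]
  | succ k ih => rw [pow_succ, pow_succ', signTranspose_mul hε, ih]

theorem signTranspose_listProd (hε : ∀ a, ε a * ε a = 1) (l : List (Matrix ι ι ℂ)) :
    signTranspose ε l.reverse.prod = (l.map (signTranspose ε)).prod := by
  induction l with
  | nil => simpa using signTranspose_pow hε 1 0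
  | cons A l ih =>
    rw [List.reverse_cons, List.prod_append, signTranspose_mul hε, ih]
    simp

theorem signTranspose_smul (c : ℂ) (A : Matrix ι ι ℂ) :
    signTranspose ε (c • A) = c • signTranspose ε A := by
  ext a b
  simp only [signTranspose, of_apply, Matrix.smul_apply, smul_eq_mul]
  ring

theorem signTranspose_mulVec (hε : ∀ a, ε a * ε a = 1) (A : Matrix ι ι ℂ) (x : ι → ℂ) :
    signTranspose ε A *ᵥ (ε * x) = ε * (x ᵥ* A) := by
  ext a
  simp only [signTranspose, mulVec, vecMul, dotProduct, of_apply, Pi.mul_apply, Finset.mul_sum]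
  refine Finset.sum_congr rfl fun b _ => ?_
  linear_combination (ε a * A b a * x b) * hε b

end Transposition

namespace Params

variable {N : ℕ} (p : Params N)

/-- After transposition the right gauge matrix plays the role of the left one. Its second column
`(e^x, 1)`, multiplied by `σᶻ`, is proportional to `(-1, e^{-x})`, which is a gauge covector for the
parameters `-α-2`, `-β`. -/
theorem mirror_coef_opD (α β u : ℂ) (k l : Fin 2) :
    (Complex.exp (-u + p.η / 2) • (p.gauge α β (u - p.η / 2))⁻¹) 1 k * p.gauge α β (p.η / 2 - u) l 1 =
      (-1) ^ (k : ℕ) * (-1) ^ (l : ℕ) *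
      ((Complex.exp (-u + p.mirror.η / 2) •
        (p.mirror.gauge (-α - 2) (-β) (u - p.mirror.η / 2))⁻¹) 0 l *
        p.mirror.gauge (-α - 2) (-β) (p.mirror.η / 2 - u) k 0) := by
  rw [exp_smul_gauge_inv, exp_smul_gauge_inv]
  simp only [gauge, show p.mirror.η = p.η from rfl, neg_mul, Complex.sinh_neg, mul_neg, div_eq_mul_inv,
    inv_neg, Matrix.smul_apply, smul_eq_mul]
  generalize (2 * Complex.sinh (β * p.η))⁻¹ = s
  fin_cases k <;> fin_cases l <;> simp <;>
    simp only [sub_eq_add_neg, add_mul, neg_mul, neg_add, neg_neg, one_mul, two_mul,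
      Complex.exp_add, Complex.exp_neg] <;>
    field_simp

theorem mirror_coef_opB (α β u : ℂ) (k l : Fin 2) :
    (Complex.exp (-u + p.η / 2) • (p.gauge α β (u - p.η / 2))⁻¹) 0 k * p.gauge α β (p.η / 2 - u) l 1 =
      -Complex.exp (2 * β * p.η) * ((-1) ^ (k : ℕ) * (-1) ^ (l : ℕ) *
      ((Complex.exp (-u + p.mirror.η / 2) •
        (p.mirror.gauge (-α - 2) (-β) (u - p.mirror.η / 2))⁻¹) 0 l *
        p.mirror.gauge (-α - 2) (-β) (p.mirror.η / 2 - u) k 1)) := by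
  rw [exp_smul_gauge_inv, exp_smul_gauge_inv]
  simp only [gauge, show p.mirror.η = p.η from rfl, neg_mul, Complex.sinh_neg, mul_neg, div_eq_mul_inv,
    inv_neg, Matrix.smul_apply, smul_eq_mul]
  generalize (2 * Complex.sinh (β * p.η))⁻¹ = s
  fin_cases k <;> fin_cases l <;> simp <;>
    simp only [sub_eq_add_neg, add_mul, neg_mul, neg_add, neg_neg, one_mul, two_mul,
      Complex.exp_add, Complex.exp_neg] <;>
    field_simp

theorem opD_eq_signTranspose (α β u : ℂ) :
    p.opD α β u = signTranspose (configSign N) (p.mirror.opA (-α - 2) (-β + 2) u) := by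
  ext s t
  rw [opD, opA, add_sub_cancel_right, signTranspose, of_apply, gaugedMonodromy_apply,
    gaugedMonodromy_apply, Finset.sum_comm, Finset.mul_sum, Finset.sum_mul]
  refine Finset.sum_congr rfl fun l _ => ?_
  rw [Finset.mul_sum, Finset.sum_mul]
  refine Finset.sum_congr rfl fun k _ => ?_
  rw [mirror_coef_opD, mirror_chain]
  simp only [signTranspose, of_apply, auxSign]
  have h1 := configSign_mul_self s
  have h2 := configSign_mul_self t
  generalize configSign N s = x at *
  generalize configSign N t = y at *
  generalize (Complex.exp (-u + p.mirror.η / 2) •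
    (p.mirror.gauge (-α - 2) (-β) (u - p.mirror.η / 2))⁻¹) 0 l *
      p.mirror.gauge (-α - 2) (-β) (p.mirror.η / 2 - u) k 0 = w
  linear_combination
    (-((-1) ^ (k : ℕ) * (-1) ^ (l : ℕ) * w * p.chain u (k, s) (l, t) * y * y)) * h1 -
    ((-1) ^ (k : ℕ) * (-1) ^ (l : ℕ) * w * p.chain u (k, s) (l, t)) * h2

theorem rightRef_eq (α β : ℂ) :
    p.rightRef α (-β + 2) =
      (∏ n : Fin N, -Complex.exp (-((α + 2) * p.η + ((N : ℂ) - ((n : ℕ) + 1) - β) * p.η + p.ξ n))) •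
        (configSign N * p.mirror.leftRef (-α - 2) (-β)) := by
  ext s
  simp only [rightRef, leftRef, configSign, Pi.smul_apply, Pi.mul_apply, smul_eq_mul,
    ← Finset.prod_mul_distrib]
  refine Finset.prod_congr rfl fun n _ => ?_
  generalize s n = a
  fin_cases a
  · simp [mirror]
    congr 1
    ring
  · simp [mirror, ← Complex.exp_add]
    rw [eq_comm, Complex.exp_eq_one_iff]
    exact ⟨0, by push_cast; ring⟩

theorem opB_eq_signTranspose (α β u : ℂ) :
    p.opB α β u = signTranspose (configSign N)
      (-Complex.exp (2 * β * p.η) • p.mirror.opB (-α - 2) (-β) u) := by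
  ext s t
  rw [opB, opB, signTranspose, of_apply, Matrix.smul_apply, smul_eq_mul, gaugedMonodromy_apply,
    gaugedMonodromy_apply, Finset.sum_comm, Finset.mul_sum, Finset.mul_sum, Finset.sum_mul]
  refine Finset.sum_congr rfl fun l _ => ?_
  rw [Finset.mul_sum, Finset.mul_sum, Finset.sum_mul]
  refine Finset.sum_congr rfl fun k _ => ?_
  rw [mirror_coef_opB, mirror_chain]
  simp only [signTranspose, of_apply, auxSign]
  have h1 := configSign_mul_self s
  have h2 := configSign_mul_self t
  generalize configSign N s = x at *
  generalize configSign N t = y at *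
  generalize (Complex.exp (-u + p.mirror.η / 2) •
    (p.mirror.gauge (-α - 2) (-β) (u - p.mirror.η / 2))⁻¹) 0 l *
      p.mirror.gauge (-α - 2) (-β) (p.mirror.η / 2 - u) k 1 = w
  generalize -Complex.exp (2 * β * p.η) = e
  linear_combination
    (-(e * (-1) ^ (k : ℕ) * (-1) ^ (l : ℕ) * w * p.chain u (k, s) (l, t) * y * y)) * h1 -
    (e * (-1) ^ (k : ℕ) * (-1) ^ (l : ℕ) * w * p.chain u (k, s) (l, t)) * h2

/-- The factor between right states and transposed left states of the mirrored chain. -/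
def mirrorFactor (α β : ℂ) : ℂ :=
  ∏ n : Fin N, -Complex.exp (-((α + 2) * p.η + ((N : ℂ) - ((n : ℕ) + 1) - β) * p.η + p.ξ n))

theorem mirrorFactor_ne_zero (α β : ℂ) : p.mirrorFactor α β ≠ 0 :=
  Finset.prod_ne_zero_iff.2 fun _ _ => neg_ne_zero.2 (Complex.exp_ne_zero _)

theorem mirrorFactor_add_two (α β : ℂ) :
    p.mirrorFactor α (β + 2) = Complex.exp (2 * N * p.η) * p.mirrorFactor α β := by
  have h : Complex.exp (2 * N * p.η) = ∏ _n : Fin N, Complex.exp (2 * p.η) := by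
    rw [Finset.prod_const, Finset.card_univ, Fintype.card_fin, ← Complex.exp_nat_mul]
    congr 1
    ring
  rw [h, mirrorFactor, mirrorFactor, ← Finset.prod_mul_distrib]
  refine Finset.prod_congr rfl fun n _ => ?_
  rw [mul_neg, ← Complex.exp_add]
  congr 2
  ring

theorem mulVec_opD (α β u r : ℂ) (x : State N) :
    p.opD α β u *ᵥ (r • (configSign N * x)) =
      r • (configSign N * (x ᵥ* p.mirror.opA (-α - 2) (-β + 2) u)) := by
  rw [mulVec_smul, opD_eq_signTranspose, signTranspose_mulVec configSign_mul_self]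

theorem mulVec_opB (α β u r : ℂ) (x : State N) :
    p.opB α β u *ᵥ (r • (configSign N * x)) =
      (-Complex.exp (2 * β * p.η) * r) •
        (configSign N * (x ᵥ* p.mirror.opB (-α - 2) (-β) u)) := by
  rw [mulVec_smul, opB_eq_signTranspose, signTranspose_mulVec configSign_mul_self, vecMul_smul,
    mul_smul_comm, smul_smul, mul_comm]

/-- Exchange of the labels `0` and `1`. -/
def flipConfig (h : Config N) : Config N := fun n => Fin.rev (h n)

theorem flipConfig_injective : Function.Injective (flipConfig (N := N)) :=
  fun _ _ h => funext fun n => Fin.rev_injective (congrFun h n)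

theorem val_flipConfig (h : Config N) (n : Fin N) : (flipConfig h n : ℕ) = 1 - (h n : ℕ) := by
  rw [flipConfig, Fin.val_rev]
  omega

theorem rightStateB_eq {α β : ℂ} {c : Fin N → ℂ} (hc : ∀ n, c n ≠ 0)
    (hβ : Complex.sinh (β * p.η) ≠ 0) (h : Config N) :
    p.rightStateB α β c h = p.mirrorFactor α β •
      (configSign N * p.mirror.leftStateB (-α - 2) (-β) c (flipConfig h)) := by
  have hβ' : Complex.sinh (-β * p.mirror.η) ≠ 0 := by
    rw [show p.mirror.η = p.η from rfl, neg_mul, Complex.sinh_neg]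
    exact neg_ne_zero.2 hβ
  -- Transposition reverses the order of the factors, so the mirrored left states are taken in
  -- decreasing order of the sites, which gives the same states.
  rw [p.mirror.leftStateB_eq hc hβ', ← p.mirror.leftRef_vecMul_listProd hc hβ' (flipConfig h)
    (l := (List.finRange N).reverse) (List.nodup_reverse.2 (List.nodup_finRange N)) (by simp),
    ← signTranspose_mulVec configSign_mul_self, ← mulVec_smul, rightStateB, rightRef_eq,
    List.map_reverse, signTranspose_listProd configSign_mul_self, rightProduct, List.ofFn_eq_map,
    List.map_map]
  congr 3
  funext n
  rw [Function.comp_apply, signTranspose_pow configSign_mul_self, signTranspose_smul,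
    ← opD_eq_signTranspose, val_flipConfig, show p.mirror.η = p.η from rfl,
    show p.mirror.ξ n = -p.ξ n from rfl, sub_neg_eq_add, add_comm (p.ξ n)]

/-- The product of the raising and lowering coefficients does not involve `τ` and is even under a
simultaneous change of sign of all `ξ`. -/
theorem mirror_qDet {αm βm : ℂ} (hζ : Complex.sinh p.ζ ≠ 0) (hκ : p.κ ≠ 0)
    (hb : p.IsBoundaryParam αm βm) (n : Fin N) : p.mirror.qDet αm βm n = p.qDet αm βm n := by
  rw [← p.raiseCoef_mul_lowerCoef_eq_qDet hζ hκ hb,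
    ← p.mirror.raiseCoef_mul_lowerCoef_eq_qDet hζ hκ hb, raiseCoef_mul_lowerCoef,
    raiseCoef_mul_lowerCoef, ← Finset.prod_mul_distrib, ← Finset.prod_mul_distrib]
  simp only [kDet, mirror, sub_neg_eq_add, ← sub_eq_add_neg, mul_neg, Complex.sinh_neg]
  congr 1
  · rw [show -p.ξ n + p.ζ = p.ζ - p.ξ n by ring, show p.ζ + p.ξ n = p.ξ n + p.ζ by ring]
    ring
  · exact Finset.prod_congr rfl fun m _ => by ring

theorem SinhGeneric.mirror {p : Params N} (hp : p.SinhGeneric) : p.mirror.SinhGeneric where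
  sub a b h := by
    have := hp.sub b a h.symm
    simp only [Params.mirror]
    rwa [show -p.ξ a - -p.ξ b = p.ξ b - p.ξ a by ring]
  sub_eta a b h := by
    have := hp.sub_eta b a h.symm
    simp only [Params.mirror]
    rwa [show p.η - -p.ξ a + -p.ξ b = p.η - p.ξ b + p.ξ a by ring]
  add a b := by
    have := hp.add a b
    simp only [Params.mirror]
    rwa [show -p.ξ a + -p.ξ b = -(p.ξ a + p.ξ b) by ring, Complex.sinh_neg, neg_ne_zero]
  add_eta a b := by
    have := hp.add_neg_eta a b
    simp only [Params.mirror]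
    rwa [show p.η + -p.ξ a + -p.ξ b = p.η - p.ξ a - p.ξ b by ring]
  add_neg_eta a b := by
    have := hp.add_eta a b
    simp only [Params.mirror]
    rwa [show p.η - -p.ξ a - -p.ξ b = p.η + p.ξ a + p.ξ b by ring]

theorem NonNilpBR.mirror {p : Params N} {αm βm α β : ℂ} (h : p.NonNilpBR αm βm α β) :
    p.mirror.NonNilpBL αm βm (-α - 2) (-β) := by
  intro k hk
  -- The `iπ` in the mirrored `τ` shifts `k` by one, and changing the overall sign replaces `k` by
  -- `-k`.
  refine h (1 - k) ?_
  have hpow : (-1 : ℂ) ^ (1 - k) = -(-1) ^ k := by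
    rw [zpow_sub₀ (by norm_num), zpow_one]
    rcases Int.even_or_odd k with hk | hk
    · rw [hk.neg_one_zpow]; norm_num
    · rw [hk.neg_one_zpow]; norm_num
  rw [hpow]
  simp only [Params.mirror] at hk
  push_cast
  linear_combination -hk

theorem aH_mirror (h : Config N) (u : ℂ) :
    p.mirror.aH (flipConfig h) u = (-1) ^ N * p.aH h (-u) := by
  have h1 : ((-1 : ℂ)) ^ N = ∏ _n : Fin N, (-1 : ℂ) := by simp
  rw [aH, aH, h1, ← Finset.prod_mul_distrib]
  refine Finset.prod_congr rfl fun n _ => ?_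
  rw [neg_one_mul, ← Complex.sinh_neg]
  congr 1
  simp only [mirror, flipConfig]
  generalize h n = a
  fin_cases a
  · simp
    ring
  · simp
    ring

/-- The factor `-e^{2βη}` comes from transposing `ℬ₋`; `e^{-2Nη}` compensates the growth of
`mirrorFactor` between `β` and `β+2`. -/
theorem rightEig_eq (α β : ℂ) (c c' : Fin N → ℂ) (h : Config N) (u : ℂ) :
    p.rightEig α β c c' h u = -Complex.exp (2 * β * p.η) * Complex.exp (-(2 * N * p.η)) *
      p.mirror.leftEig (-α - 2) (-β) c c' (flipConfig h) u := by
  have h1 : ∏ n, (c' n / c n) ^ (flipConfig h n : ℕ) = ∏ n, (c' n / c n) ^ (1 - (h n : ℕ)) := by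
    simp only [val_flipConfig]
  have h2 : Complex.sinh ((N + -β - (-α - 2) - 1) * p.η - (-p.τ + Real.pi * Complex.I)) =
      Complex.sinh ((β - (1 + N + α)) * p.η - p.τ) := by
    rw [show (N + -β - (-α - 2) - 1) * p.η - (-p.τ + Real.pi * Complex.I) =
      -((β - (1 + N + α)) * p.η - p.τ) - Real.pi * Complex.I by ring, Complex.sinh_sub]
    rw [Complex.cosh_mul_I, Complex.sinh_mul_I, Complex.cos_pi, Complex.sin_pi, Complex.sinh_neg]
    ring
  have h3 : Complex.exp (2 * β * p.η) * Complex.exp (-(2 * N * p.η)) *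
      Complex.exp ((-β + N) * p.η) = Complex.exp ((β - N) * p.η) := by
    rw [← Complex.exp_add, ← Complex.exp_add]
    congr 1
    ring
  have h4 : ((-1 : ℂ) ^ N) * (-1) ^ N = 1 := by
    rw [← mul_pow]; simp
  rw [rightEig, leftEig, aH_mirror, aH_mirror, neg_neg, h1, ← h3]
  simp only [mirror]
  rw [h2, neg_mul β, Complex.sinh_neg]
  simp only [div_eq_mul_inv, mul_inv, inv_neg]
  generalize (-1 : ℂ) ^ N = e at *
  linear_combination (-(e * (Complex.exp (2 * β * p.η) * Complex.exp (-(2 * N * p.η)) *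
    Complex.exp ((-β + N) * p.η) * ∏ x, (c' x * (c x)⁻¹) ^ (1 - (h x : ℕ))) * p.aH h u *
    p.aH h (-u) * (Complex.sinh (2 * u - p.η) *
      (2 * p.κ * Complex.sinh ((β - (1 + N + α)) * p.η - p.τ) - Complex.exp p.ζ) *
      (2⁻¹ * (Complex.sinh p.ζ)⁻¹ * (Complex.sinh (β * p.η))⁻¹)))) * h4

theorem right_representation {αm βm : ℂ} (hη : Complex.sinh p.η ≠ 0) (hζ : Complex.sinh p.ζ ≠ 0)
    (hκ : p.κ ≠ 0) (hb : p.IsBoundaryParam αm βm) (hp : p.SinhGeneric) {α β : ℂ} {c c' : Fin N → ℂ}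
    (hc : ∀ n, c n ≠ 0) (hc' : ∀ n, c' n ≠ 0) (hβ : Complex.sinh (β * p.η) ≠ 0)
    (hβ' : Complex.sinh ((β + 2) * p.η) ≠ 0)
    (hB : ∀ j : ℕ, j < N → p.NonNilpBR αm βm α (β + 2 * j)) :
    IsPseudoEigenbasis (rightAct (p.opB α β)) (p.rightStateB α β c) (p.rightStateB α (β + 2) c')
      (p.rightEig α β c c') ∧
    ActsByShifts p (rightAct (p.opD α β)) (p.rightStateB α β c) c
      (fun n => p.qDet αm βm n / c n) ∧
    (p.NonNilpBR αm βm α (β + 2 * N) → IsBasis (p.rightStateB α (β + 2) c')) := by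
  have hs : ∀ {x : ℂ}, Complex.sinh (x * p.η) ≠ 0 → Complex.sinh (-x * p.mirror.η) ≠ 0 := by
    intro x hx
    rw [show p.mirror.η = p.η from rfl, neg_mul, Complex.sinh_neg]
    exact neg_ne_zero.2 hx
  have hbm : p.mirror.IsBoundaryParam αm βm := hb
  have hN : ∀ {x : ℂ} (y : ℂ), -x = y → p.NonNilpBR αm βm α x → p.mirror.NonNilp (-α - 2) y := by
    rintro x y rfl hx
    exact NonNilpBL.nonNilp (p := p.mirror) hκ hbm hx.mirror
  have hβ2 : -(β + 2) = -β - 2 := by ring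
  obtain ⟨⟨hL1, hL2, hL3⟩, hL4, hL5⟩ := p.mirror.left_representation hη hζ hκ hbm hp.mirror
    (α := -α - 2) (β := -β) hc hc' (hs hβ) (by rw [← hβ2]; exact hs hβ')
    (fun j hj => hN _ (by ring) (hB j hj))
  have hbasis : ∀ {β : ℂ} {c : Fin N → ℂ}, (∀ n, c n ≠ 0) → Complex.sinh (β * p.η) ≠ 0 →
      IsBasis (p.mirror.leftStateB (-α - 2) (-β) c) → IsBasis (p.rightStateB α β c) := by
    intro β c hc hβ h
    apply isBasis_of_linearIndependent
    have h1 := h.1.comp _ flipConfig_injective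
    let f : State N →ₗ[ℂ] State N :=
      p.mirrorFactor α β • LinearMap.mulLeft ℂ (configSign N)
    have hf : LinearMap.ker f = ⊥ := by
      rw [LinearMap.ker_eq_bot']
      intro x hx
      ext s
      have h2 := congrFun hx s
      have h3 := configSign_mul_self s
      simp [f, p.mirrorFactor_ne_zero] at h2
      rcases h2 with h2 | h2
      · simp [h2] at h3
      · exact h2
    have h2 : p.rightStateB α β c =
        f ∘ p.mirror.leftStateB (-α - 2) (-β) c ∘ flipConfig := by
      ext1 h
      rw [p.rightStateB_eq hc hβ]
      rfl
    rw [h2]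
    exact h1.map' f hf
  refine ⟨⟨hbasis hc hβ hL1, fun h u => ?_, fun h k hhk t ht => ?_⟩, fun h n => ?_, fun hB' => ?_⟩
  · have := hL2 (flipConfig h) u
    simp only [leftAct] at this
    rw [rightAct, p.rightStateB_eq hc hβ, p.rightStateB_eq hc' hβ', mulVec_opB, this, rightEig_eq, hβ2,
      mirrorFactor_add_two, mul_smul_comm, smul_smul, smul_smul]
    congr 1
    have h3 : Complex.exp (-(2 * N * p.η)) * Complex.exp (2 * N * p.η) = 1 := by
      rw [← Complex.exp_add]; simp
    linear_combination (Complex.exp (2 * β * p.η) * p.mirrorFactor α β *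
      p.mirror.leftEig (-α - 2) (-β) c c' (flipConfig h) u) * h3
  · refine hL3 (flipConfig h) (flipConfig k) (fun hh => hhk (flipConfig_injective hh)) t ?_
    ext u
    have h1 := congrFun ht u
    rw [Pi.smul_apply, smul_eq_mul, rightEig_eq, rightEig_eq] at h1
    have h2 : -Complex.exp (2 * β * p.η) * Complex.exp (-(2 * N * p.η)) ≠ 0 :=
      mul_ne_zero (neg_ne_zero.2 (Complex.exp_ne_zero _)) (Complex.exp_ne_zero _)
    rw [Pi.smul_apply, smul_eq_mul]
    apply mul_left_cancel₀ h2
    linear_combination h1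
  -- The mirror flips the labels and changes `ξₙ` to `-ξₙ`, so its lowering relations become raising
  -- relations and conversely.
  · obtain ⟨h0, h1⟩ := hL4 (flipConfig h) n
    have hu : ∀ a, Function.update (flipConfig h) n (Fin.rev a) =
        flipConfig (Function.update h n a) := by
      intro a
      ext1 m
      by_cases hm : m = n
      · subst hm
        simp [flipConfig]
      · simp [flipConfig, hm]
    simp only [leftAct, show p.mirror.η = p.η from rfl, show p.mirror.ξ n = -p.ξ n from rfl,
      p.mirror_qDet hζ hκ hb] at h0 h1
    have hu0 := hu 0
    have hu1 := hu 1
    simp only [rightAct, p.rightStateB_eq hc hβ, mulVec_opD]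
    constructor
    · intro hn
      obtain ⟨h2, h3⟩ := h1 (by simp [flipConfig, hn])
      rw [show -p.ξ n + p.η / 2 = -(p.ξ n - p.η / 2) by ring] at h2 h3
      rw [neg_neg] at h3
      rw [h2, h3]
      refine ⟨by simp, ?_⟩
      rw [mul_smul_comm, smul_comm]
      congr 4
    · intro hn
      obtain ⟨h2, h3⟩ := h0 (by simp [flipConfig, hn])
      rw [show -p.ξ n - p.η / 2 = -(p.ξ n + p.η / 2) by ring] at h2 h3
      rw [neg_neg] at h3
      rw [h2, h3]
      refine ⟨?_, by simp⟩
      rw [mul_smul_comm, smul_comm]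
      congr 4
  · refine hbasis hc' hβ' ?_
    rw [hβ2]
    exact hL5 (hN _ (by ring) hB')

/-! ### Reduction of `𝒞₋` to `ℬ₋`, and the theorem -/

/-- Changing the sign of `β` swaps the two columns of the gauge matrix, so the gauged monodromy
matrix is conjugated by a permutation. -/
theorem gaugedMonodromy_neg (α β u : ℂ) (i j : Fin 2) :
    p.gaugedMonodromy α (-β) u i j = p.gaugedMonodromy α β u (Fin.rev i) (Fin.rev j) := by
  ext s t
  rw [gaugedMonodromy_apply, gaugedMonodromy_apply]
  refine Finset.sum_congr rfl fun k _ => Finset.sum_congr rfl fun l _ => ?_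
  rw [exp_smul_gauge_inv, exp_smul_gauge_inv, neg_mul, Complex.sinh_neg]
  congr 2
  · rw [Matrix.smul_apply, Matrix.smul_apply, mul_neg, div_neg]
    fin_cases i <;> fin_cases k <;> simp <;> ring_nf <;> simp
  · fin_cases j <;> fin_cases l <;> simp [gauge] <;> ring_nf

theorem opC_eq (α β : ℂ) : p.opC α β = p.opB α (2 - β) := by
  ext1 u
  rw [opC, opB, ← neg_sub β 2, gaugedMonodromy_neg]
  rfl

theorem opA_eq (α β : ℂ) : p.opA α β = p.opD α (2 - β) := by
  ext1 u
  rw [opA, opD, ← neg_sub β 2, gaugedMonodromy_neg]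
  rfl

theorem opD_eq (α β : ℂ) : p.opD α β = p.opA α (2 - β) := by
  rw [opA_eq, sub_sub_cancel]

theorem leftStateC_eq (α β : ℂ) (c : Fin N → ℂ) : p.leftStateC α β c = p.leftStateB α (2 - β) c := by
  ext1 h
  rw [leftStateC, leftStateB, opD_eq, show 2 - (β - 2) = 2 - β + 2 by ring,
    show -β + 2 = 2 - β by ring]

theorem rightStateC_eq (α β : ℂ) (c : Fin N → ℂ) :
    p.rightStateC α β c = p.rightStateB α (2 - β) c := by
  ext1 h
  rw [rightStateC, rightStateB, opA_eq, show -(2 - β) + 2 = β by ring]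

end Params

end

end OpenXXZ

theorem mainTheorem3 {N : ℕ} (p : OpenXXZ.Params N) (αm βm : ℂ)
    (hη : Complex.sinh p.η ≠ 0) (hζ : Complex.sinh p.ζ ≠ 0) (hκ : p.κ ≠ 0)
    (hbdry : p.IsBoundaryParam αm βm) (hξ : p.Generic)
    (α β : ℂ) (c c' : Fin N → ℂ) (hc : ∀ n, c n ≠ 0) (hc' : ∀ n, c' n ≠ 0) :
    -- left representation for the `B` generators
    (Complex.sinh (β * p.η) ≠ 0 → Complex.sinh ((β - 2) * p.η) ≠ 0 →
      (∀ j : ℕ, j < N → p.NonNilpBL αm βm α (β - 2 * j)) →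
      OpenXXZ.IsPseudoEigenbasis (OpenXXZ.leftAct (p.opB α β))
        (p.leftStateB α β c) (p.leftStateB α (β - 2) c') (p.leftEig α β c c') ∧
      OpenXXZ.ActsByShifts p (OpenXXZ.leftAct (p.opA α (β + 2))) (p.leftStateB α β c)
        (fun n => p.qDet αm βm n / c n) c ∧
      (p.NonNilpBL αm βm α (β - 2 * N) → OpenXXZ.IsBasis (p.leftStateB α (β - 2) c'))) ∧
    -- right representation for the `B` generators
    (Complex.sinh (β * p.η) ≠ 0 → Complex.sinh ((β + 2) * p.η) ≠ 0 →
      (∀ j : ℕ, j < N → p.NonNilpBR αm βm α (β + 2 * j)) →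
      OpenXXZ.IsPseudoEigenbasis (OpenXXZ.rightAct (p.opB α β))
        (p.rightStateB α β c) (p.rightStateB α (β + 2) c') (p.rightEig α β c c') ∧
      OpenXXZ.ActsByShifts p (OpenXXZ.rightAct (p.opD α β)) (p.rightStateB α β c)
        c (fun n => p.qDet αm βm n / c n) ∧
      (p.NonNilpBR αm βm α (β + 2 * N) → OpenXXZ.IsBasis (p.rightStateB α (β + 2) c'))) ∧
    -- left representation for the `C` generators
    (Complex.sinh ((β - 2) * p.η) ≠ 0 → Complex.sinh (β * p.η) ≠ 0 →
      (∀ j : ℕ, j < N → p.NonNilpCL αm βm α (β + 2 * j)) →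
      OpenXXZ.IsPseudoEigenbasis (OpenXXZ.leftAct (p.opC α β))
        (p.leftStateC α β c) (p.leftStateC α (β + 2) c') (p.leftEig α (2 - β) c c') ∧
      OpenXXZ.ActsByShifts p (OpenXXZ.leftAct (p.opD α (β - 2))) (p.leftStateC α β c)
        (fun n => p.qDet αm βm n / c n) c ∧
      (p.NonNilpCL αm βm α (β + 2 * N) → OpenXXZ.IsBasis (p.leftStateC α (β + 2) c'))) ∧
    -- right representation for the `C` generators
    (Complex.sinh ((β - 2) * p.η) ≠ 0 → Complex.sinh ((β - 4) * p.η) ≠ 0 →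
      (∀ j : ℕ, j < N → p.NonNilpCR αm βm α (β - 2 * j)) →
      OpenXXZ.IsPseudoEigenbasis (OpenXXZ.rightAct (p.opC α β))
        (p.rightStateC α β c) (p.rightStateC α (β - 2) c') (p.rightEig α (2 - β) c c') ∧
      OpenXXZ.ActsByShifts p (OpenXXZ.rightAct (p.opA α β)) (p.rightStateC α β c)
        c (fun n => p.qDet αm βm n / c n) ∧
      (p.NonNilpCR αm βm α (β - 2 * N) → OpenXXZ.IsBasis (p.rightStateC α (β - 2) c'))) := by
  have hS := hξ.sinhGeneric
  have hneg : ∀ {x y : ℂ}, -x = y → Complex.sinh (x * p.η) ≠ 0 → Complex.sinh (y * p.η) ≠ 0 := by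
    rintro x y rfl hx
    rwa [neg_mul, Complex.sinh_neg, neg_ne_zero]
  refine ⟨fun h1 h2 hB => ?_, p.right_representation hη hζ hκ hbdry hS hc hc',
    fun h1 h2 hC => ?_, fun h1 h2 hC => ?_⟩
  · obtain ⟨hP, hA, hI⟩ := p.left_representation hη hζ hκ hbdry hS hc hc' h1 h2
      fun j hj => (hB j hj).nonNilp hκ hbdry
    exact ⟨hP, hA, fun h => hI (h.nonNilp hκ hbdry)⟩
  · have hN : ∀ {x y : ℂ}, 2 - x = y → p.NonNilpCL αm βm α x → p.NonNilp α y := by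
      rintro x y rfl h
      exact h.nonNilpBL.nonNilp hκ hbdry
    obtain ⟨hP, hA, hI⟩ := p.left_representation (α := α) (β := 2 - β) hη hζ hκ hbdry hS hc hc'
      (hneg (by ring) h1) (hneg (by ring) h2) fun j hj => hN (by ring) (hC j hj)
    rw [p.opC_eq, p.leftStateC_eq, p.leftStateC_eq, p.opD_eq, show 2 - (β + 2) = 2 - β - 2 by ring,
      show 2 - (β - 2) = 2 - β + 2 by ring]
    exact ⟨hP, hA, fun h => hI (hN (by ring) h)⟩
  · have hN : ∀ {x y : ℂ}, 2 - x = y → p.NonNilpCR αm βm α x → p.NonNilpBR αm βm α y := by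
      rintro x y rfl h
      exact h.nonNilpBR
    obtain ⟨hP, hA, hI⟩ := p.right_representation (α := α) (β := 2 - β) hη hζ hκ hbdry hS hc hc'
      (hneg (by ring) h1) (hneg (by ring) h2) fun j hj => hN (by ring) (hC j hj)
    rw [p.opC_eq, p.rightStateC_eq, p.rightStateC_eq, p.opA_eq,
      show 2 - (β - 2) = 2 - β + 2 by ring]
    exact ⟨hP, hA, fun h => hI (hN (by ring) h)⟩
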